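/- Let $n\ge 1$, let $U(\mathfrak{gl}_n)$ and $U(\mathfrak{sl}_n)$ be the universal enveloping algebras of $\mathfrak{gl}_n(\mathbb C)$ and $\mathfrak{sl}_n(\mathbb C)$, and let $Z(\mathfrak{gl}_n)$, $Z(\mathfrak{sl}_n)$ be their centers. Let $\lambda=(\lambda_1,\dots,\lambda_n)\in\mathbb C^n$ be a dominant weight, i.e. $\lambda_i-\lambda_{i+1}\in\mathbb Z_{\ge 0}$ for $1\le i<n$, and let $\pi_\lambda:\mathfrak{gl}_n(\mathbb C)\to\operatorname{End}(V_\lambda)$ be the finite-dimensional irreducible representation with highest weight $\lambda$. Put $$\Omega_\lambda=\sum_{i,j=1}^n E_{ij}\otimes\pi_\lambda(E_{ji})\in U(\mathfrak{gl}_n)\otimes\operatorname{End}(V_\lambda),\qquad \omega_\lambda=\sum_\alpha I_\alpha\otimes\pi_\lambda(I^\alpha)\in U(\mathfrak{sl}_n)\otimes\operatorname{End}(V_\lambda),$$ where $\{I_\alpha\}$ is the basis of $\mathfrak{sl}_n(\mathbb C)$ consisting of the $E_{ij}$ $(i\ne j)$ and $H_i=E_{ii}-E_{i+1,i+1}$ $(1\le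 i<n)$, and $\{I^\alpha\}$ is its dual basis for the trace form $(x,y)\mapsto\operatorname{tr}(xy)$, so that $E_{ij}^*=E_{ji}$ and $H_i^*=(E_{11}+\dots+E_{ii})-\frac in(E_{11}+\dots+E_{nn})$. A polynomial $\sum_k z_ku^k$ with central coefficients is evaluated at an element $A$ of the tensor product as $\sum_k (z_k\otimes 1)A^k$. Let $\Delta_1=E_{11}+\dots+E_{nn}\in Z(\mathfrak{gl}_n)$ and $d=\lambda_1+\dots+\lambda_n$. Then there exist a polynomial $p(u)$ with coefficients in $Z(\mathfrak{sl}_n)$ and a polynomial $P_\lambda(u)$ with coefficients in $Z(\mathfrak{gl}_n)$, both of degree $\dim V_\lambda$, such that $$p(\omega_\lambda)=0,\qquad P_\lambda(\Omega_\lambda)=0,\qquad P_\lambda(u)=p\Bigl(u-\frac dn\,\Delta_1\Bigr),$$ where in the last identity $U(\mathfrak{sl}_n)$ is mapped to $U(\mathfrak{gl}_n)$ by the homomorphism induced by the inclusion $\mathfrak{sl}_n\subset\mathfrak{gl}_n$. -/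

import Mathlib

open scoped TensorProduct

attribute [local instance] LieRing.ofAssociativeRing

noncomputable section

namespace BraidedCasimir

/-- The general linear Lie algebra over the complex numbers: all complex `n × n` matrices with the
commutator bracket. -/
abbrev gl (n : ℕ) : Type := Matrix (Fin n) (Fin n) ℂ

/-- The special linear Lie algebra over the complex numbers: the trace zero matrices. -/
abbrev sl (n : ℕ) : LieSubalgebra ℂ (gl n) := LieAlgebra.SpecialLinear.sl (Fin n) ℂ

/-- The universal enveloping algebra of a complex Lie algebra. -/
abbrev U (L : Type*) [LieRing L] [LieAlgebra ℂ L] : Type _ := UniversalEnvelopingAlgebra ℂ L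

/-- The center of the universal enveloping algebra. -/
abbrev Z (L : Type*) [LieRing L] [LieAlgebra ℂ L] : Subalgebra ℂ (U L) :=
  Subalgebra.center ℂ (U L)

/-- The standard matrix unit. -/
abbrev E {n : ℕ} (i j : Fin n) : gl n := Matrix.single i j 1

/-- A dominant weight: consecutive differences are natural numbers. -/
def IsDominant {n : ℕ} (lam : Fin n → ℂ) : Prop :=
  ∀ i j : Fin n, (j : ℕ) = (i : ℕ) + 1 → ∃ k : ℕ, lam i - lam j = (k : ℂ)

/-- The module `V` contains a highest weight vector of weight `lam`: a nonzero vector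
killed by the strictly upper triangular matrix units, on which `E i i` acts by `lam i`. -/
def HasHighestWeight {n : ℕ} (V : Type*) [AddCommGroup V] [Module ℂ V] [LieRingModule (gl n) V]
    (lam : Fin n → ℂ) : Prop :=
  ∃ v : V, v ≠ 0 ∧ (∀ i : Fin n, ⁅E i i, v⁆ = lam i • v) ∧
    ∀ i j : Fin n, i < j → ⁅E i j, v⁆ = 0

/-- The irreducible representation of `gl n` with highest weight `lam` (unique up to isomorphism):
`V` is irreducible, finite-dimensional, and has highest weight `lam`. -/
structure IsIrrepOfHighestWeight {n : ℕ} (V : Type*) [AddCommGroup V] [Module ℂ V]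
    [LieRingModule (gl n) V] [LieModule ℂ (gl n) V] (lam : Fin n → ℂ) : Prop where
  finiteDimensional : FiniteDimensional ℂ V
  irreducible : LieModule.IsIrreducible ℂ (gl n) V
  highestWeight : HasHighestWeight V lam

/-- The braided Casimir element `∑ E i j ⊗ π (E j i)` of `U(gl n) ⊗ End V`. -/
def Omega (n : ℕ) (V : Type*) [AddCommGroup V] [Module ℂ V]
    [LieRingModule (gl n) V] [LieModule ℂ (gl n) V] : U (gl n) ⊗[ℂ] Module.End ℂ V :=
  ∑ i : Fin n, ∑ j : Fin n,
    UniversalEnvelopingAlgebra.ι ℂ (E i j) ⊗ₜ[ℂ] LieModule.toEnd ℂ (gl n) V (E j i)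

/-- The matrix unit `E i j` with `i ≠ j`, as an element of `sl n`. -/
def slE {n : ℕ} (i j : Fin n) (h : i ≠ j) : sl n :=
  LieAlgebra.SpecialLinear.single i j h 1

/-- With zero-based indices, the matrix `E i i - E (i + 1) (i + 1)` of `sl n`. -/
def slH {n : ℕ} (i : Fin (n - 1)) : sl n :=
  LieAlgebra.SpecialLinear.singleSubSingle ⟨i, by omega⟩ ⟨(i : ℕ) + 1, by omega⟩ 1

/-- With zero-based indices, `(E 0 0 + ⋯ + E i i) - ((i + 1) / n) • 1`. -/
def slHdual {n : ℕ} (i : Fin (n - 1)) : sl n :=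
  ⟨(∑ k : Fin n, if (k : ℕ) ≤ (i : ℕ) then E k k else 0) - (((i : ℕ) + 1 : ℂ) / (n : ℂ)) • 1, by
    refine LinearMap.mem_ker.mpr ?_
    have hn : (n : ℂ) ≠ 0 := by
      have := i.2
      exact_mod_cast (by omega : n ≠ 0)
    have hi : (i : ℕ) + 1 ≤ n := by omega
    have hc : (Finset.univ.filter fun k : Fin n => (k : ℕ) ≤ (i : ℕ)).card = (i : ℕ) + 1 := by
      have h := Fin.card_filter_val_lt (n := n) (m := (i : ℕ) + 1)
      simp only [Nat.lt_succ_iff, Nat.min_eq_right hi] at h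
      exact h
    have h1 : ∀ k : Fin n, Matrix.trace (if (k : ℕ) ≤ (i : ℕ) then E k k else (0 : gl n)) =
        if (k : ℕ) ≤ (i : ℕ) then (1 : ℂ) else 0 := by
      intro k
      split_ifs <;> simp
    simp only [map_sub, map_sum, map_smul, Matrix.traceLinearMap_apply, h1, Matrix.trace_one,
      Fintype.card_fin, Finset.sum_boole, hc, smul_eq_mul]
    push_cast
    field_simp
    ring⟩

/-- The braided Casimir element of `sl n` in `U(sl n) ⊗ End V`, for a representation `V` of `gl n`
restricted to `sl n`: it is `∑ I_a ⊗ π (I^a)` for the basis of `sl n` formed by the `E i j` with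
`i ≠ j` and the `H i = E i i - E (i + 1) (i + 1)`, and its dual basis for the trace form
`(x, y) ↦ tr (x y)`. -/
def omegaSl (n : ℕ) (V : Type*) [AddCommGroup V] [Module ℂ V]
    [LieRingModule (gl n) V] [LieModule ℂ (gl n) V] : U (sl n) ⊗[ℂ] Module.End ℂ V :=
  (∑ i : Fin n, ∑ j : Fin n, if h : i ≠ j then
      UniversalEnvelopingAlgebra.ι ℂ (slE i j h) ⊗ₜ[ℂ] LieModule.toEnd ℂ (sl n) V (slE j i h.symm)
    else 0) +
  ∑ i : Fin (n - 1),
    UniversalEnvelopingAlgebra.ι ℂ (slH i) ⊗ₜ[ℂ] LieModule.toEnd ℂ (sl n) V (slHdual i)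

/-- The value `∑ (z_k ⊗ 1) * A ^ k` of the polynomial `∑ z_k u ^ k` with central coefficients at an
element `A` of `U(L) ⊗ End V`. -/
def evalAt {L : Type*} [LieRing L] [LieAlgebra ℂ L] {V : Type*} [AddCommGroup V] [Module ℂ V]
    (A : U L ⊗[ℂ] Module.End ℂ V) (P : Polynomial (Z L)) : U L ⊗[ℂ] Module.End ℂ V :=
  P.eval₂ (((Algebra.TensorProduct.includeLeft :
    U L →ₐ[ℂ] U L ⊗[ℂ] Module.End ℂ V).comp (Z L).val).toRingHom) A

/-- The homomorphism `U(sl n) → U(gl n)` induced by the inclusion. -/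
def UslToUgl (n : ℕ) : U (sl n) →ₐ[ℂ] U (gl n) :=
  UniversalEnvelopingAlgebra.lift ℂ ((UniversalEnvelopingAlgebra.ι ℂ).comp (sl n).incl)

/-- The central element `E 1 1 + ⋯ + E n n` of `U(gl n)`. -/
def Delta (n : ℕ) : U (gl n) := ∑ i : Fin n, UniversalEnvelopingAlgebra.ι ℂ (E i i)

end BraidedCasimir

end

noncomputable section

namespace BraidedCasimir

/-! ### The polarization module and the faithfulness of `U(gl n)` on it -/

/-! The algebra `U(gl n)` acts faithfully on polynomial functions on matrices
(`uAct_matPoly_injective`), and that module is generated by its highest weight vectors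
(`mem_lieSpan_isSingular`). So an identity in `U(gl n) ⊗ End V` may be checked on the submodules
generated by `f ⊗ V`, with `f` a highest weight vector of some weight `μ`.

On such a submodule `Omega` is triangular: for a weight basis `b k` of `V`, with weights `ν`, it
acts on `f ⊗ b k` by a scalar modulo the submodule generated by `f` tensored with basis vectors of
smaller depth (`omegaAct_sub_mem`). The product over `k` of `Omega` minus these scalars is therefore
zero. Writing `C` for the quadratic Casimir eigenvalue, the scalar is `(C(μ + ν) - C(μ) - C(λ)) / 2
= ⟨ν, l⟩ + κ(ν)`, with `l` the shifted weight and `κ` symmetric. The Weyl group acts on `V` and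
permutes the weights (`exists_unit_perm`), so the product over `k` of `u - ⟨ν, l⟩ - κ(ν)` has
coefficients symmetric in `l` (`coeff_charPoly_isSymmetric`). Each symmetric polynomial in `l` is
the scalar of a central element (`exists_central_of_isSymmetric`), by way of the traces of powers of
the generator matrix. Putting these central elements for the coefficients gives a monic identity for
`Omega`.

For `sl n`, the split Casimir tensor of `gl n` is that of `sl n` plus `(1/n) 1 ⊗ 1`. The projection
`gl n → sl n` kills `1`, hence carries `Omega` to `omegaSl` and the identity to one for `sl n`, with
polynomial `p`. Under the inclusion `omegaSl` becomes `Omega - (d/n) Δ`, so `p(u - (d/n) Δ)`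
annihilates `Omega`. -/

/-- Polynomial functions on `n × n` matrices. -/
abbrev MatPoly (n : ℕ) : Type := MvPolynomial (Fin n × Fin n) ℂ

/-- The action of `gl n` on polynomial functions by polarization operators. -/
def polarization (n : ℕ) : gl n →ₗ⁅ℂ⁆ Derivation ℂ (MatPoly n) (MatPoly n) where
  toFun X := MvPolynomial.mkDerivation ℂ fun p => ∑ i, X i p.1 • MvPolynomial.X (i, p.2)
  map_add' X Y := by
    ext p : 1
    simp [MvPolynomial.mkDerivation_X, add_smul, Finset.sum_add_distrib]
  map_smul' c X := by
    ext p : 1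
    simp [MvPolynomial.mkDerivation_X, mul_smul, Finset.smul_sum]
  map_lie' {X Y} := by
    ext p : 1
    rw [Derivation.commutator_apply]
    simp only [MvPolynomial.mkDerivation_X, map_sum, Derivation.map_smul, Ring.lie_def,
      Matrix.sub_apply, Matrix.mul_apply, sub_smul, Finset.sum_smul, Finset.sum_sub_distrib,
      Finset.smul_sum, smul_smul]
    congr 1
    · rw [Finset.sum_comm]
      simp only [mul_comm]
    · rw [Finset.sum_comm]
      exact Finset.sum_congr rfl fun _ _ => Finset.sum_congr rfl fun _ _ => by rw [mul_comm]

lemma polarization_X {n : ℕ} (Y : gl n) (p : Fin n × Fin n) :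
    polarization n Y (MvPolynomial.X p) = ∑ i, Y i p.1 • MvPolynomial.X (i, p.2) :=
  MvPolynomial.mkDerivation_X _ _ _

lemma polarization_E_X {n : ℕ} (i j : Fin n) (p : Fin n × Fin n) :
    polarization n (E i j) (MvPolynomial.X p) =
      if p.1 = j then MvPolynomial.X (i, p.2) else 0 := by
  rw [polarization_X]
  rw [Finset.sum_eq_single i]
  · by_cases h : p.1 = j
    · simp [h]
    · simp [h, Ne.symm h]
  · intro b _ hb
    simp [Ne.symm hb]
  · simp

/-- The polarization action as a representation. -/
def polarizationEnd (n : ℕ) : gl n →ₗ⁅ℂ⁆ Module.End ℂ (MatPoly n) where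
  toFun X := (polarization n X : MatPoly n →ₗ[ℂ] MatPoly n)
  map_add' X Y := by rw [map_add]; rfl
  map_smul' c X := by rw [map_smul]; rfl
  map_lie' {X Y} := by
    rw [LieHom.map_lie, Derivation.commutator_coe_linear_map]

instance (n : ℕ) : LieRingModule (gl n) (MatPoly n) :=
  LieRingModule.compLieHom (MatPoly n) (polarizationEnd n)

instance (n : ℕ) : LieModule ℂ (gl n) (MatPoly n) :=
  LieModule.compLieHom (MatPoly n) (polarizationEnd n)

lemma lie_matPoly {n : ℕ} (X : gl n) (f : MatPoly n) : ⁅X, f⁆ = polarization n X f := rfl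

/-- The action of the enveloping algebra on a Lie module. -/
def uAct (L M : Type*) [LieRing L] [LieAlgebra ℂ L] [AddCommGroup M] [Module ℂ M]
    [LieRingModule L M] [LieModule ℂ L M] : U L →ₐ[ℂ] Module.End ℂ M :=
  UniversalEnvelopingAlgebra.lift ℂ (LieModule.toEnd ℂ L M)

@[simp] lemma uAct_ι {L M : Type*} [LieRing L] [LieAlgebra ℂ L] [AddCommGroup M] [Module ℂ M]
    [LieRingModule L M] [LieModule ℂ L M] (x : L) (m : M) :
    uAct L M (UniversalEnvelopingAlgebra.ι ℂ x) m = ⁅x, m⁆ := by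
  rw [uAct, UniversalEnvelopingAlgebra.lift_ι_apply]
  rfl

/-- The generators of an enveloping algebra generate it. -/
lemma adjoin_range_ι (L : Type*) [LieRing L] [LieAlgebra ℂ L] :
    Algebra.adjoin ℂ (Set.range (UniversalEnvelopingAlgebra.ι ℂ : L → U L)) = ⊤ := by
  set S := Algebra.adjoin ℂ (Set.range (UniversalEnvelopingAlgebra.ι ℂ : L → U L)) with hS
  have hmem : ∀ x : L, UniversalEnvelopingAlgebra.ι ℂ x ∈ S := fun x =>
    Algebra.subset_adjoin ⟨x, rfl⟩
  let g : L →ₗ⁅ℂ⁆ S :=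
    { toFun := fun x => ⟨UniversalEnvelopingAlgebra.ι ℂ x, hmem x⟩
      map_add' := fun x y => Subtype.ext (map_add _ x y)
      map_smul' := fun c x => Subtype.ext (map_smul _ c x)
      map_lie' := fun {x y} => Subtype.ext (by
        simp [LieHom.map_lie, LieRing.of_associative_ring_bracket]) }
  -- The identity factors through `S`, by uniqueness in the universal property.
  have h : S.val.comp (UniversalEnvelopingAlgebra.lift ℂ g) = AlgHom.id ℂ (U L) := by
    apply UniversalEnvelopingAlgebra.hom_ext
    ext x
    simp only [LieHom.coe_comp, Function.comp_apply, AlgHom.coe_toLieHom, AlgHom.comp_apply,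
      UniversalEnvelopingAlgebra.lift_ι_apply]
    rfl
  rw [eq_top_iff]
  intro x _
  have := congrArg (fun F => F x) h
  simp only [AlgHom.comp_apply, AlgHom.id_apply] at this
  rw [← this]
  exact (UniversalEnvelopingAlgebra.lift ℂ g x).2

/-! ### Filtration by word length, and symbols -/

/-- Matrix units in the enveloping algebra. -/
def uE {n : ℕ} (p : Fin n × Fin n) : U (gl n) := UniversalEnvelopingAlgebra.ι ℂ (E p.1 p.2)

/-- The product of the matrix units along a list. -/
def wordProd {n : ℕ} (l : List (Fin n × Fin n)) : U (gl n) := (l.map uE).prod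

@[simp] lemma wordProd_cons {n : ℕ} (p : Fin n × Fin n) (l : List (Fin n × Fin n)) :
    wordProd (p :: l) = uE p * wordProd l := by simp [wordProd]

/-- The span of the words of length less than `d`. -/
def wordFil (n d : ℕ) : Submodule ℂ (U (gl n)) :=
  Submodule.span ℂ {y | ∃ l : List (Fin n × Fin n), l.length < d ∧ wordProd l = y}

lemma wordProd_mem {n d : ℕ} {l : List (Fin n × Fin n)} (h : l.length < d) :
    wordProd l ∈ wordFil n d := Submodule.subset_span ⟨l, h, rfl⟩

lemma wordFil_mono {n d e : ℕ} (h : d ≤ e) : wordFil n d ≤ wordFil n e := by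
  apply Submodule.span_mono
  rintro _ ⟨l, hl, rfl⟩
  exact ⟨l, hl.trans_le h, rfl⟩

lemma uE_mul_mem {n d : ℕ} (p : Fin n × Fin n) {y : U (gl n)} (hy : y ∈ wordFil n d) :
    uE p * y ∈ wordFil n (d + 1) := by
  induction hy using Submodule.span_induction with
  | mem x hx =>
    obtain ⟨l, hl, rfl⟩ := hx
    rw [← wordProd_cons]
    exact wordProd_mem (by simpa using hl)
  | zero => simp
  | add x y _ _ hx hy => rw [mul_add]; exact add_mem hx hy
  | smul c x _ hx => rw [mul_smul_comm]; exact Submodule.smul_mem _ _ hx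

lemma gl_eq_sum {n : ℕ} (X : gl n) : X = ∑ i, ∑ j, X i j • E i j := by
  conv_lhs => rw [Matrix.matrix_eq_sum_single X]
  simp [E, Matrix.smul_single]

lemma ι_mul_mem {n d : ℕ} (X : gl n) {y : U (gl n)} (hy : y ∈ wordFil n d) :
    UniversalEnvelopingAlgebra.ι ℂ X * y ∈ wordFil n (d + 1) := by
  rw [gl_eq_sum X]
  simp only [map_sum, map_smul, Finset.sum_mul, smul_mul_assoc]
  exact Submodule.sum_mem _ fun i _ => Submodule.sum_mem _ fun j _ =>
    Submodule.smul_mem _ _ (uE_mul_mem (i, j) hy)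

lemma exists_mem_wordFil {n : ℕ} (y : U (gl n)) : ∃ d, y ∈ wordFil n d := by
  have hy : y ∈ Algebra.adjoin ℂ
      (Set.range (UniversalEnvelopingAlgebra.ι ℂ : gl n → U (gl n))) := by
    rw [adjoin_range_ι]; trivial
  rw [← Subalgebra.mem_toSubmodule, Algebra.adjoin_eq_span] at hy
  induction hy using Submodule.span_induction with
  | mem x hx =>
    induction hx using Submonoid.closure_induction_left with
    | one => exact ⟨1, wordProd_mem (l := []) (by simp)⟩
    | mul_left x hx y _ ih =>
      obtain ⟨X, rfl⟩ := hx
      obtain ⟨d, hd⟩ := ih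
      exact ⟨d + 1, ι_mul_mem X hd⟩
  | zero => exact ⟨0, zero_mem _⟩
  | add x y _ _ hx hy =>
    obtain ⟨d, hd⟩ := hx
    obtain ⟨e, he⟩ := hy
    exact ⟨max d e, add_mem (wordFil_mono (le_max_left _ _) hd)
      (wordFil_mono (le_max_right _ _) he)⟩
  | smul c x _ hx => exact hx.imp fun d hd => Submodule.smul_mem _ _ hd

/-- Exchanging two adjacent letters costs a bracket, which is linear in the generators, so the error
consists of shorter words. -/
lemma wordProd_perm {n : ℕ} {l l' : List (Fin n × Fin n)} (h : l.Perm l') :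
    wordProd l - wordProd l' ∈ wordFil n l.length := by
  induction h with
  | nil => simp
  | cons p _ ih =>
    rw [wordProd_cons, wordProd_cons, ← mul_sub]
    exact uE_mul_mem p ih
  | swap p q l =>
    simp only [wordProd_cons, ← mul_assoc, ← sub_mul]
    have : uE q * uE p - uE p * uE q = UniversalEnvelopingAlgebra.ι ℂ ⁅E q.1 q.2, E p.1 p.2⁆ := by
      rw [LieHom.map_lie, LieRing.of_associative_ring_bracket]; rfl
    rw [this]
    exact ι_mul_mem _ (wordProd_mem (by simp))
  | trans h1 h2 ih1 ih2 =>
    rw [← h1.length_eq] at ih2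
    simpa using add_mem ih1 ih2

/-- A linear section of the symbol map: a monomial is sent to a product of matrix units. -/
def monomialLift (n : ℕ) : MatPoly n →ₗ[ℂ] U (gl n) :=
  (MvPolynomial.basisMonomials (Fin n × Fin n) ℂ).constr ℂ fun m =>
    wordProd (Finsupp.toMultiset m).toList

lemma monomialLift_monomial {n : ℕ} (m : (Fin n × Fin n) →₀ ℕ) :
    monomialLift n (MvPolynomial.monomial m 1) = wordProd (Finsupp.toMultiset m).toList := by
  have h := (MvPolynomial.basisMonomials (Fin n × Fin n) ℂ).constr_basis ℂ
    (fun m => (wordProd (Finsupp.toMultiset m).toList : U (gl n))) m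
  rwa [MvPolynomial.coe_basisMonomials] at h

/-- This is only the spanning half of Poincaré–Birkhoff–Witt; that the symbol is determined by `y`
is seen later from the action. -/
lemma exists_symbol {n d : ℕ} {y : U (gl n)} (hy : y ∈ wordFil n (d + 1)) :
    ∃ q : MatPoly n, q.IsHomogeneous d ∧ y - monomialLift n q ∈ wordFil n d := by
  induction hy using Submodule.span_induction with
  | mem x hx =>
    obtain ⟨l, hl, rfl⟩ := hx
    rcases (Nat.lt_succ_iff.mp hl).lt_or_eq with h | h
    · exact ⟨0, MvPolynomial.isHomogeneous_zero _ _ _, by simpa using wordProd_mem h⟩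
    · refine ⟨MvPolynomial.monomial (Multiset.toFinsupp (l : Multiset (Fin n × Fin n))) 1, ?_, ?_⟩
      · apply MvPolynomial.isHomogeneous_monomial
        rw [← h, Finsupp.degree_eq_sum]
        have := Finsupp.card_toMultiset (Multiset.toFinsupp (l : Multiset (Fin n × Fin n)))
        rw [Multiset.toFinsupp_toMultiset, Multiset.coe_card] at this
        rw [this, Finsupp.sum_fintype _ _ (by simp)]
        rfl
      · rw [monomialLift_monomial, Multiset.toFinsupp_toMultiset, ← h]
        apply wordProd_perm
        rw [← Multiset.coe_eq_coe, Multiset.coe_toList]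
  | zero => exact ⟨0, MvPolynomial.isHomogeneous_zero _ _ _, by simp⟩
  | add x y _ _ hx hy =>
    obtain ⟨q, hq, h⟩ := hx
    obtain ⟨r, hr, h'⟩ := hy
    refine ⟨q + r, hq.add hr, ?_⟩
    rw [map_add, add_sub_add_comm]
    exact add_mem h h'
  | smul c x _ hx =>
    obtain ⟨q, hq, h⟩ := hx
    refine ⟨c • q, ?_, ?_⟩
    · exact Submodule.smul_mem (MvPolynomial.homogeneousSubmodule _ ℂ d) c hq
    · rw [map_smul, ← smul_sub]
      exact Submodule.smul_mem _ _ h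

/-! ### Recovering the symbol from the action near the identity matrix -/

/-- Evaluation at the identity matrix. -/
def evOne (n : ℕ) : MatPoly n →ₐ[ℂ] ℂ :=
  MvPolynomial.aeval fun p => if p.1 = p.2 then 1 else 0

/-- The ideal of polynomials vanishing at the identity matrix. -/
abbrev idOne (n : ℕ) : Ideal (MatPoly n) := RingHom.ker (evOne n)

/-- Linear forms vanishing at the identity matrix. -/
def linForm {n : ℕ} (a : Fin n × Fin n → ℂ) : MatPoly n :=
  ∑ p, a p • (MvPolynomial.X (p.2, p.1) - MvPolynomial.C (if p.1 = p.2 then 1 else 0))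

lemma linForm_mem {n : ℕ} (a : Fin n × Fin n → ℂ) : linForm a ∈ idOne n := by
  rw [RingHom.mem_ker]
  simp [linForm, evOne, eq_comm]

/-- The transposed index in `linForm` serves this: among the coordinates, only `(j, i)` is sent by
`E i j` to one not vanishing at the identity, namely `(i, i)`. -/
lemma evOne_polarization_linForm {n : ℕ} (a : Fin n × Fin n → ℂ) (p : Fin n × Fin n) :
    evOne n (polarization n (E p.1 p.2) (linForm a)) = a p := by
  simp only [linForm, map_sum, Derivation.map_smul, map_sub, MvPolynomial.derivation_C, sub_zero,
    polarization_E_X]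
  rw [Finset.sum_eq_single p]
  · simp [evOne]
  · intro q _ hq
    by_cases h : q.2 = p.2
    · have : q.1 ≠ p.1 := fun h' => hq (Prod.ext h' h)
      simp [h, evOne, this.symm]
    · simp [h]
  · simp

/-- By the Leibniz rule a derivation lowers the order of vanishing by at most one. -/
lemma derivation_mem_pow {A : Type*} [CommRing A] [Algebra ℂ A] (D : Derivation ℂ A A)
    (I : Ideal A) (k : ℕ) {f : A} (hf : f ∈ I ^ k) : D f ∈ I ^ (k - 1) := by
  induction k generalizing f with
  | zero => simp
  | succ k ih =>
    rw [pow_succ] at hf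
    induction hf using Submodule.mul_induction_on' with
    | mem_mul_mem b hb a ha =>
      rw [Derivation.leibniz, smul_eq_mul, smul_eq_mul]
      refine add_mem (Ideal.mul_mem_right _ _ hb) ?_
      rcases k with _ | k
      · simp
      · rw [Nat.add_sub_cancel, pow_succ']
        exact Ideal.mul_mem_mul ha (ih hb)
    | add x _ y _ hx hy => rw [map_add]; exact add_mem hx hy

/-- To leading order each letter `p` differentiates one factor `linForm a` and replaces it by `a p`;
the successive exponents multiply to the descending factorial, and `e` factors survive. -/
lemma word_linForm {n : ℕ} (a : Fin n × Fin n → ℂ) (l : List (Fin n × Fin n)) (e : ℕ) :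
    uAct (gl n) (MatPoly n) (wordProd l) (linForm a ^ (l.length + e)) -
      (((l.length + e).descFactorial l.length : ℂ) * (l.map a).prod) • linForm a ^ e ∈
      idOne n ^ (e + 1) := by
  induction l generalizing e with
  | nil => simp [wordProd]
  | cons p l ih =>
    have h := ih (e + 1)
    have hl : (p :: l).length + e = l.length + (e + 1) := by simp; ring
    rw [hl, wordProd_cons, map_mul, Module.End.mul_apply]
    have h2 := derivation_mem_pow (polarization n (E p.1 p.2)) _ _ h
    rw [map_sub, Derivation.map_smul, Derivation.leibniz_pow, Nat.add_sub_cancel,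
      Nat.add_sub_cancel] at h2
    simp only [uE, uAct_ι, lie_matPoly, List.map_cons, List.prod_cons, List.length_cons]
    have h3 : polarization n (E p.1 p.2) (linForm a) - MvPolynomial.C (a p) ∈ idOne n := by
      rw [RingHom.mem_ker, map_sub, evOne_polarization_linForm]
      simp [evOne]
    have h4 := Ideal.mul_mem_mul (Ideal.pow_mem_pow (linForm_mem a) e) h3
    rw [← pow_succ] at h4
    -- Two errors add up: the derivative of the previous one, and the one from replacing the
    -- derivative of `linForm a` by its value at the identity.
    have h5 := add_mem h2 (Submodule.smul_of_tower_mem _ ((((l.length + (e + 1)).descFactorial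
      l.length : ℂ) * (l.map a).prod) * (e + 1)) h4)
    convert h5 using 1
    have hf : (l.length + (e + 1)).descFactorial (l.length + 1) =
        (e + 1) * (l.length + (e + 1)).descFactorial l.length := by
      rw [Nat.descFactorial_succ, Nat.add_sub_cancel_left]
    rw [hf]
    simp only [nsmul_eq_mul, smul_eq_mul (a := linForm a ^ e)]
    simp only [Algebra.smul_def, MvPolynomial.algebraMap_eq, map_mul,
      Nat.cast_mul, Nat.cast_add, Nat.cast_one, map_add, map_one, map_natCast]
    ring

lemma evOne_word {n : ℕ} (a : Fin n × Fin n → ℂ) (l : List (Fin n × Fin n)) :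
    evOne n (uAct (gl n) (MatPoly n) (wordProd l) (linForm a ^ l.length)) =
      (l.length.factorial : ℂ) * (l.map a).prod := by
  have h := word_linForm a l 0
  rw [zero_add, pow_one, RingHom.mem_ker, map_sub, sub_eq_zero] at h
  simpa [Nat.descFactorial_self] using h

lemma evOne_word_of_lt {n : ℕ} (a : Fin n × Fin n → ℂ) (l : List (Fin n × Fin n)) {d : ℕ}
    (hd : l.length < d) :
    evOne n (uAct (gl n) (MatPoly n) (wordProd l) (linForm a ^ d)) = 0 := by
  obtain ⟨e, rfl⟩ := Nat.exists_eq_add_of_lt hd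
  have h := Ideal.pow_le_self (by omega) (word_linForm a l (e + 1))
  have ht : evOne n (linForm a) = 0 := linForm_mem a
  rw [RingHom.mem_ker, map_sub, map_smul, map_pow (evOne n), ht] at h
  simpa [add_assoc] using h

lemma evOne_of_mem_wordFil {n d : ℕ} (a : Fin n × Fin n → ℂ) {y : U (gl n)}
    (hy : y ∈ wordFil n d) : evOne n (uAct (gl n) (MatPoly n) y (linForm a ^ d)) = 0 := by
  induction hy using Submodule.span_induction with
  | mem x hx =>
    obtain ⟨l, hl, rfl⟩ := hx
    exact evOne_word_of_lt a l hl
  | zero => simp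
  | add x y _ _ hx hy => simp [hx, hy]
  | smul c x _ hx => simp [hx]

lemma evOne_monomialLift {n d : ℕ} (a : Fin n × Fin n → ℂ) {q : MatPoly n}
    (hq : q.IsHomogeneous d) :
    evOne n (uAct (gl n) (MatPoly n) (monomialLift n q) (linForm a ^ d)) =
      (d.factorial : ℂ) * MvPolynomial.eval a q := by
  conv_lhs => rw [q.as_sum]
  conv_rhs => rw [q.as_sum]
  simp only [map_sum, LinearMap.sum_apply, Finset.mul_sum]
  refine Finset.sum_congr rfl fun m hm => ?_
  have hd : (Finsupp.toMultiset m).toList.length = d := by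
    rw [Multiset.length_toList, Finsupp.card_toMultiset]
    have := hq (MvPolynomial.mem_support_iff.mp hm)
    rw [← this, Finsupp.weight_apply]
    simp [Finsupp.sum]
  have h1 : MvPolynomial.monomial m (MvPolynomial.coeff m q) =
      MvPolynomial.coeff m q • MvPolynomial.monomial m 1 := by
    rw [MvPolynomial.smul_monomial, smul_eq_mul, mul_one]
  rw [h1, map_smul, map_smul, LinearMap.smul_apply, map_smul, monomialLift_monomial]
  conv_lhs => rw [← hd, evOne_word]
  have h2 : ((Finsupp.toMultiset m).toList.map a).prod = MvPolynomial.eval a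
      (MvPolynomial.monomial m 1) := by
    rw [← Multiset.prod_coe, ← Multiset.map_coe, Multiset.coe_toList, MvPolynomial.eval_monomial,
      one_mul, Finsupp.toMultiset_map, Finsupp.prod_toMultiset, Finsupp.prod_mapDomain_index]
    · exact fun _ => pow_zero _
    · exact fun _ _ _ => pow_add _ _ _
  rw [hd, MvPolynomial.smul_eval, h2, smul_eq_mul]
  ring

/-- The enveloping algebra of `gl n` acts faithfully on the polarization module. -/
theorem uAct_matPoly_injective (n : ℕ) : Function.Injective (uAct (gl n) (MatPoly n)) := by
  rw [injective_iff_map_eq_zero]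
  intro y hy
  obtain ⟨d, hd⟩ := exists_mem_wordFil y
  induction d with
  | zero => simpa [wordFil] using hd
  | succ d ih =>
    apply ih
    -- On `linForm a ^ d`, evaluated at the identity, shorter words give zero and the symbol gives
    -- `d! * q(a)`. As `y` acts by zero, `q` vanishes everywhere and `y` drops one step in the
    -- filtration.
    obtain ⟨q, hq, h⟩ := exists_symbol hd
    have hq0 : q = 0 := by
      apply MvPolynomial.funext
      intro a
      have h1 := evOne_of_mem_wordFil a h
      rw [map_sub, hy, zero_sub, LinearMap.neg_apply, map_neg, neg_eq_zero,
        evOne_monomialLift a hq] at h1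
      have : (d.factorial : ℂ) ≠ 0 := by exact_mod_cast d.factorial_ne_zero
      simpa [this] using h1
    rwa [hq0, map_zero, sub_zero] at h

end BraidedCasimir

namespace BraidedCasimir

/-! ### Highest weight vectors -/

/-- The vector `v` is killed by the strictly upper triangular matrix units and has weight `mu`. -/
def IsSingular {n : ℕ} {M : Type*} [AddCommGroup M] [Module ℂ M] [LieRingModule (gl n) M]
    (mu : Fin n → ℂ) (v : M) : Prop :=
  (∀ i : Fin n, ⁅E i i, v⁆ = mu i • v) ∧ ∀ i j : Fin n, i < j → ⁅E i j, v⁆ = 0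

/-- The invariant subspace `P` is cut down by one eigenspace at a time; commutation keeps it
invariant under the whole family. -/
lemma exists_common_eigenvector {ι K M : Type*} [Field K] [IsAlgClosed K] [AddCommGroup M]
    [Module K M] [FiniteDimensional K M] (T : ι → Module.End K M)
    (hT : ∀ i j, Commute (T i) (T j)) (s : Finset ι) (P : Submodule K M) (hP : P ≠ ⊥)
    (hPT : ∀ i, ∀ v ∈ P, T i v ∈ P) :
    ∃ v ∈ P, v ≠ 0 ∧ ∀ i ∈ s, ∃ c : K, T i v = c • v := by
  classical
  induction s using Finset.induction_on generalizing P with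
  | empty =>
    obtain ⟨v, hv, hv0⟩ := Submodule.exists_mem_ne_zero_of_ne_bot hP
    exact ⟨v, hv, hv0, by simp⟩
  | insert a s _ ih =>
    have : Nontrivial P := Submodule.nontrivial_iff_ne_bot.mpr hP
    obtain ⟨c, hc⟩ := Module.End.exists_eigenvalue ((T a).restrict (hPT a))
    obtain ⟨w, hw⟩ := hc.exists_hasEigenvector
    have hw1 : T a w = c • (w : M) := congrArg Subtype.val hw.apply_eq_smul
    obtain ⟨v, hv, hv0, hvs⟩ := ih (P ⊓ (T a).eigenspace c)
      (fun h => hw.2 (Subtype.ext ((Submodule.eq_bot_iff _).mp h w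
        ⟨w.2, Module.End.mem_eigenspace_iff.mpr hw1⟩)))
      (fun i v hv => ⟨hPT i v hv.1, by
        rw [SetLike.mem_coe, Module.End.mem_eigenspace_iff, ← Module.End.mul_apply, (hT a i).eq,
          Module.End.mul_apply, Module.End.mem_eigenspace_iff.mp hv.2, map_smul]⟩)
    refine ⟨v, hv.1, hv0, fun i hi => ?_⟩
    rcases Finset.mem_insert.mp hi with rfl | hi
    · exact ⟨c, Module.End.mem_eigenspace_iff.mp hv.2⟩
    · exact hvs i hi

lemma lie_E_E {n : ℕ} (i j k l : Fin n) :
    ⁅E i j, E k l⁆ = (if j = k then E i l else 0) - if l = i then E k j else 0 := by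
  rw [Ring.lie_def]
  congr 1
  · split_ifs with h
    · subst h; simp [E]
    · simp [E, h]
  · split_ifs with h
    · subst h; simp [E]
    · simp [E, h]

/-- The diagonal matrix measuring the height of a weight. -/
def heightElt (n : ℕ) : gl n := ∑ i : Fin n, (-(i : ℂ)) • E i i

lemma lie_heightElt_E {n : ℕ} (i j : Fin n) :
    ⁅heightElt n, E i j⁆ = ((j : ℂ) - (i : ℂ)) • E i j := by
  rw [heightElt, sum_lie]
  simp only [smul_lie, lie_E_E, smul_sub, Finset.sum_sub_distrib, smul_ite, smul_zero,
    Finset.sum_ite_eq, Finset.sum_ite_eq', Finset.mem_univ, if_true]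
  module

/-- A nonzero finite-dimensional module has a highest weight vector. -/
theorem exists_isSingular {n : ℕ} (M : Type*) [AddCommGroup M] [Module ℂ M]
    [LieRingModule (gl n) M] [LieModule ℂ (gl n) M] [FiniteDimensional ℂ M] [Nontrivial M] :
    ∃ (mu : Fin n → ℂ) (v : M), v ≠ 0 ∧ IsSingular mu v := by
  set H := LieModule.toEnd ℂ (gl n) M (heightElt n) with hH
  have hfin : {c | H.HasEigenvalue c}.Finite := H.finite_hasEigenvalue
  obtain ⟨c₀, hc₀⟩ := Module.End.exists_eigenvalue H
  -- For `i < j`, `E i j` adds the positive integer `j - i` to a height eigenvalue, so it kills the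
  -- eigenspace of largest real part; the commuting diagonal units have a joint eigenvector there.
  obtain ⟨c, hc, hmax⟩ := hfin.exists_maximalFor Complex.re _ ⟨c₀, hc₀⟩
  have key : ∀ i j : Fin n, ∀ v ∈ H.eigenspace c, H ⁅E i j, v⁆ = (c + (j - i)) • ⁅E i j, v⁆ := by
    intro i j v hv
    have hv' : ⁅heightElt n, v⁆ = c • v := Module.End.mem_eigenspace_iff.mp hv
    rw [hH, LieModule.toEnd_apply_apply, leibniz_lie, lie_heightElt_E, hv', lie_smul, smul_lie]
    module
  obtain ⟨v, hv, hv0, hvs⟩ := exists_common_eigenvector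
    (fun i : Fin n => LieModule.toEnd ℂ (gl n) M (E i i))
    (fun i j => by
      rw [commute_iff_lie_eq, ← LieHom.map_lie, lie_E_E]
      split_ifs with h1 h2 h2 <;> simp_all) Finset.univ (H.eigenspace c) hc
    (fun i v hv => by
      have h := key i i v hv
      rw [sub_self, add_zero] at h
      exact Module.End.mem_eigenspace_iff.mpr h)
  choose mu hmu using fun i => hvs i (Finset.mem_univ i)
  refine ⟨mu, v, hv0, hmu, fun i j hij => ?_⟩
  by_contra hne
  have h1 : H.HasEigenvalue (c + (j - i)) := Module.End.hasEigenvalue_of_hasEigenvector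
    ⟨Module.End.mem_eigenspace_iff.mpr (key i j v hv), hne⟩
  have hlt : c.re < (c + ((j : ℂ) - (i : ℂ))).re := by
    have : ((i : ℕ) : ℝ) < ((j : ℕ) : ℝ) := by exact_mod_cast hij
    simp [this]
  exact absurd (hmax h1 hlt.le) (not_le.mpr hlt)

/-! ### The Fischer inner product -/

lemma derivation_sum_apply {A ι : Type*} [CommRing A] [Algebra ℂ A] (s : Finset ι)
    (D : ι → Derivation ℂ A A) (f : A) : (∑ i ∈ s, D i) f = ∑ i ∈ s, D i f := by
  rw [← Derivation.coeFnAddMonoidHom_apply, map_sum, Finset.sum_apply]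
  rfl

lemma polarization_E_eq {n : ℕ} (i j : Fin n) (f : MatPoly n) :
    polarization n (E i j) f =
      ∑ a, MvPolynomial.X (i, a) * MvPolynomial.pderiv (j, a) f := by
  have : polarization n (E i j) =
      ∑ a, (MvPolynomial.X (i, a) : MatPoly n) • MvPolynomial.pderiv (j, a) := by
    ext p : 1
    rw [polarization_E_X, derivation_sum_apply]
    simp only [Derivation.smul_apply, MvPolynomial.pderiv_X, smul_eq_mul]
    rw [Finset.sum_eq_single p.2]
    · by_cases h : p.1 = j
      · subst h; simp
      · have : p ≠ (j, p.2) := fun h' => h (congrArg Prod.fst h')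
        simp [h, this]
    · intro a _ ha
      have : p ≠ (j, a) := fun h' => ha (congrArg Prod.snd h').symm
      simp [this]
    · simp
  rw [this, derivation_sum_apply]
  rfl

lemma totalDegree_X_mul_pderiv_le {σ : Type*} (p q : σ) {f : MvPolynomial σ ℂ} :
    (MvPolynomial.X p * MvPolynomial.pderiv q f).totalDegree ≤ f.totalDegree := by
  classical
  by_cases h0 : MvPolynomial.pderiv q f = 0
  · simp [h0]
  have h1 : (MvPolynomial.pderiv q f).totalDegree + 1 ≤ f.totalDegree := by
    have hne : (MvPolynomial.pderiv q f).support.Nonempty := by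
      rwa [Finset.nonempty_iff_ne_empty, Ne, MvPolynomial.support_eq_empty]
    obtain ⟨m, hm, hmd⟩ := Finset.exists_mem_eq_sup _ hne fun s => s.sum fun _ e => e
    rw [MvPolynomial.totalDegree, hmd]
    rw [MvPolynomial.mem_support_iff, MvPolynomial.coeff_pderiv] at hm
    have h2 := MvPolynomial.le_totalDegree (MvPolynomial.mem_support_iff.mpr (left_ne_zero_of_mul hm))
    rwa [Finsupp.sum_add_index' (by simp) (by simp), Finsupp.sum_single_index rfl] at h2
  refine (MvPolynomial.totalDegree_mul _ _).trans ?_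
  rw [MvPolynomial.totalDegree_X]
  omega

/-- Bounded degree cuts out finite-dimensional submodules, where highest weight vectors exist. -/
lemma totalDegree_polarization_le {n : ℕ} (X : gl n) (f : MatPoly n) :
    (polarization n X f).totalDegree ≤ f.totalDegree := by
  rw [gl_eq_sum X]
  simp only [map_sum, map_smul, derivation_sum_apply, Derivation.smul_apply]
  refine MvPolynomial.totalDegree_finsetSum_le fun i _ =>
    MvPolynomial.totalDegree_finsetSum_le fun j _ => (MvPolynomial.totalDegree_smul_le _ _).trans ?_
  rw [polarization_E_eq]
  exact MvPolynomial.totalDegree_finsetSum_le fun a _ => totalDegree_X_mul_pderiv_le _ _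

/-- The Fischer inner product, for which the monomials are orthogonal with squared norm the product
of the factorials of the exponents. -/
def fischer {σ : Type*} (f g : MvPolynomial σ ℂ) : ℂ :=
  ∑ m ∈ f.support, ((m.prod fun _ k => (k.factorial : ℂ)) *
    (starRingEnd ℂ (MvPolynomial.coeff m f) * MvPolynomial.coeff m g))

lemma fischer_eq_sum {σ : Type*} {f : MvPolynomial σ ℂ} (g : MvPolynomial σ ℂ)
    {s : Finset (σ →₀ ℕ)} (hs : f.support ⊆ s) :
    fischer f g = ∑ m ∈ s, ((m.prod fun _ k => (k.factorial : ℂ)) *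
      (starRingEnd ℂ (MvPolynomial.coeff m f) * MvPolynomial.coeff m g)) := by
  refine Finset.sum_subset hs fun m _ hm => ?_
  rw [MvPolynomial.notMem_support_iff.mp hm]
  simp

lemma fischer_add_left {σ : Type*} (f f' g : MvPolynomial σ ℂ) :
    fischer (f + f') g = fischer f g + fischer f' g := by
  classical
  rw [fischer_eq_sum g (MvPolynomial.support_add),
    fischer_eq_sum g (Finset.subset_union_left (s₂ := f'.support)),
    fischer_eq_sum g (Finset.subset_union_right (s₁ := f.support)), ← Finset.sum_add_distrib]
  refine Finset.sum_congr rfl fun m _ => ?_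
  rw [MvPolynomial.coeff_add, map_add]
  ring

lemma fischer_smul_left {σ : Type*} (c : ℂ) (f g : MvPolynomial σ ℂ) :
    fischer (c • f) g = starRingEnd ℂ c * fischer f g := by
  rw [fischer_eq_sum g (MvPolynomial.support_smul), fischer, Finset.mul_sum]
  refine Finset.sum_congr rfl fun m _ => ?_
  rw [MvPolynomial.coeff_smul, smul_eq_mul, map_mul]
  ring

lemma fischer_conj {σ : Type*} (f g : MvPolynomial σ ℂ) :
    starRingEnd ℂ (fischer g f) = fischer f g := by
  classical
  rw [fischer_eq_sum g (Finset.subset_union_left (s₂ := g.support)),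
    fischer_eq_sum f (Finset.subset_union_right (s₁ := f.support)), map_sum]
  refine Finset.sum_congr rfl fun m _ => ?_
  simp only [map_mul, Complex.conj_conj, Finsupp.prod, map_prod, map_natCast]
  ring

lemma fischer_self {σ : Type*} (f : MvPolynomial σ ℂ) :
    fischer f f = ((∑ m ∈ f.support, ((m.prod fun _ k => (k.factorial : ℝ)) *
      Complex.normSq (MvPolynomial.coeff m f)) : ℝ) : ℂ) := by
  rw [fischer, Complex.ofReal_sum]
  refine Finset.sum_congr rfl fun m _ => ?_
  rw [← Complex.normSq_eq_conj_mul_self]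
  simp [Finsupp.prod]

/-- The inner product space structure given by the Fischer inner product. -/
@[reducible] def fischerCore (σ : Type*) : InnerProductSpace.Core ℂ (MvPolynomial σ ℂ) where
  inner := fischer
  conj_inner_symm := fischer_conj
  re_inner_nonneg f := by
    rw [fischer_self]
    refine Finset.sum_nonneg fun m _ => mul_nonneg ?_ (Complex.normSq_nonneg _)
    exact Finset.prod_nonneg fun _ _ => Nat.cast_nonneg _
  add_left := fischer_add_left
  smul_left f g c := fischer_smul_left c f g
  definite f hf := by
    rw [fischer_self, Complex.ofReal_eq_zero, Finset.sum_eq_zero_iff_of_nonneg] at hf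
    · ext m
      by_contra hm
      have h := hf m (MvPolynomial.mem_support_iff.mpr hm)
      have h1 : (m.prod fun _ k => (k.factorial : ℝ)) ≠ 0 :=
        Finset.prod_ne_zero_iff.mpr fun _ _ => Nat.cast_ne_zero.mpr (Nat.factorial_ne_zero _)
      exact hm (Complex.normSq_eq_zero.mp ((mul_eq_zero.mp h).resolve_left h1))
    · intro m _
      exact mul_nonneg (Finset.prod_nonneg fun _ _ => Nat.cast_nonneg _) (Complex.normSq_nonneg _)

lemma fischer_sum_left {σ ι : Type*} (s : Finset ι) (f : ι → MvPolynomial σ ℂ)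
    (g : MvPolynomial σ ℂ) : fischer (∑ i ∈ s, f i) g = ∑ i ∈ s, fischer (f i) g := by
  classical
  induction s using Finset.induction_on with
  | empty => simp [fischer]
  | insert a s ha ih => rw [Finset.sum_insert ha, Finset.sum_insert ha, fischer_add_left, ih]

lemma fischer_monomial {σ : Type*} (m : σ →₀ ℕ) (c : ℂ) (g : MvPolynomial σ ℂ) :
    fischer (MvPolynomial.monomial m c) g =
      (m.prod fun _ k => (k.factorial : ℂ)) * (starRingEnd ℂ c * MvPolynomial.coeff m g) := by
  classical
  rw [fischer_eq_sum g MvPolynomial.support_monomial_subset, Finset.sum_singleton,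
    MvPolynomial.coeff_monomial, if_pos rfl]

/-- The factorial weights are chosen for this: `(m p + 1)! = (m p + 1) * (m p)!` absorbs the factor
produced by differentiation. -/
lemma fischer_X_mul {σ : Type*} (p : σ) (f g : MvPolynomial σ ℂ) :
    fischer (MvPolynomial.X p * f) g = fischer f (MvPolynomial.pderiv p g) := by
  classical
  induction f using MvPolynomial.induction_on' with
  | monomial m c =>
    rw [MvPolynomial.X, MvPolynomial.monomial_mul, one_mul, fischer_monomial, fischer_monomial,
      MvPolynomial.coeff_pderiv, add_comm m]
    have : ((Finsupp.single p 1 + m).prod fun _ k => (k.factorial : ℂ)) =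
        (m p + 1) * m.prod fun _ k => (k.factorial : ℂ) := by
      rw [Finsupp.prod_of_support_subset (s := insert p m.support) _ ?_ _ (by simp),
        Finsupp.prod_of_support_subset m (s := insert p m.support) (Finset.subset_insert _ _) _
          (by simp), ← Finset.mul_prod_erase _ _ (Finset.mem_insert_self p _),
        ← Finset.mul_prod_erase _ _ (Finset.mem_insert_self p _), ← mul_assoc]
      · congr 1
        · rw [Finsupp.add_apply, Finsupp.single_eq_same, add_comm, Nat.factorial_succ]
          push_cast
          ring
        · refine Finset.prod_congr rfl fun q hq => ?_
          rw [Finsupp.add_apply, Finsupp.single_eq_of_ne (Finset.ne_of_mem_erase hq), zero_add]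
      · refine Finsupp.support_add.trans (Finset.union_subset ?_ (Finset.subset_insert _ _))
        exact Finsupp.support_single_subset.trans (by simp)
    rw [this]
    ring
  | add f f' hf hf' => rw [mul_add, fischer_add_left, fischer_add_left, hf, hf']

/-- Since the adjoint of a matrix unit is again a matrix unit, orthogonal complements of submodules
are stable: Weyl's unitary trick in algebraic form. -/
lemma fischer_polarization {n : ℕ} (i j : Fin n) (f g : MatPoly n) :
    fischer (polarization n (E i j) f) g = fischer f (polarization n (E j i) g) := by
  rw [← fischer_conj f, polarization_E_eq, polarization_E_eq, fischer_sum_left, fischer_sum_left,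
    map_sum]
  refine Finset.sum_congr rfl fun a _ => ?_
  rw [fischer_X_mul, fischer_X_mul, fischer_conj]

/-- The polarization module is generated by its highest weight vectors. -/
theorem mem_lieSpan_isSingular {n : ℕ} (f : MatPoly n) :
    f ∈ LieSubmodule.lieSpan ℂ (gl n) {g : MatPoly n | ∃ mu : Fin n → ℂ, IsSingular mu g} := by
  let _ := fischerCore (Fin n × Fin n)
  let _ : NormedAddCommGroup (MatPoly n) := InnerProductSpace.Core.toNormedAddCommGroup (𝕜 := ℂ)
  let _ : InnerProductSpace ℂ (MatPoly n) := InnerProductSpace.ofCore _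
  have hinner : ∀ g h : MatPoly n, inner ℂ g h = fischer g h := fun _ _ => rfl
  set A := MvPolynomial.restrictTotalDegree (Fin n × Fin n) ℂ f.totalDegree with hA
  have hAL : ∀ (X : gl n), ∀ g ∈ A, ⁅X, g⁆ ∈ A := by
    intro X g hg
    rw [hA, MvPolynomial.mem_restrictTotalDegree] at hg ⊢
    exact (totalDegree_polarization_le X g).trans hg
  set W := LieSubmodule.lieSpan ℂ (gl n) {g : MatPoly n | g ∈ A ∧ ∃ mu : Fin n → ℂ, IsSingular mu g} with hW
  have hWA : W.toSubmodule ≤ A := by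
    let A' : LieSubmodule ℂ (gl n) (MatPoly n) := { A with lie_mem := fun {X g} hg => hAL X g hg }
    exact LieSubmodule.lieSpan_le (N := A').mpr fun g hg => hg.1
  have : FiniteDimensional ℂ A := inferInstance
  have : FiniteDimensional ℂ W.toSubmodule := Submodule.finiteDimensional_of_le hWA
  let K : LieSubmodule ℂ (gl n) (MatPoly n) :=
    { W.toSubmoduleᗮ ⊓ A with
      lie_mem := fun {X g} hg => by
        refine ⟨?_, hAL X g hg.2⟩
        have h0 : ∀ w ∈ W, fischer w g = 0 := fun w hw => (Submodule.mem_orthogonal _ _).mp hg.1 w hw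
        refine (Submodule.mem_orthogonal _ _).mpr fun w hw => ?_
        rw [hinner, gl_eq_sum X]
        simp only [sum_lie, smul_lie]
        rw [← fischer_conj, fischer_sum_left, map_sum]
        refine Finset.sum_eq_zero fun i _ => ?_
        rw [fischer_sum_left, map_sum]
        refine Finset.sum_eq_zero fun j _ => ?_
        rw [fischer_smul_left, map_mul, lie_matPoly, fischer_polarization, fischer_conj,
          ← lie_matPoly, h0 _ (W.lie_mem hw)]
        simp }
  -- Otherwise `K` has a highest weight vector, which lies in `W` by definition and is then
  -- orthogonal to itself.
  have hK : ∀ g ∈ K, g = 0 := by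
    by_contra! hne
    obtain ⟨g, hg, hg0⟩ := hne
    have : Nontrivial K := ⟨⟨⟨g, hg⟩, 0, fun h => hg0 (congrArg Subtype.val h)⟩⟩
    have : FiniteDimensional ℂ K := Submodule.finiteDimensional_of_le (inf_le_right : _ ≤ A)
    obtain ⟨mu, v, hv0, hv⟩ := exists_isSingular (n := n) K
    have hv' : IsSingular mu (v : MatPoly n) :=
      ⟨fun i => congrArg Subtype.val (hv.1 i), fun i j h => congrArg Subtype.val (hv.2 i j h)⟩
    have hvW : (v : MatPoly n) ∈ W := LieSubmodule.subset_lieSpan ⟨v.2.2, mu, hv'⟩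
    have := (Submodule.mem_orthogonal _ _).mp v.2.1 v hvW
    exact hv0 (Subtype.ext (inner_self_eq_zero.mp this))
  obtain ⟨w, hw, u, hu, hfu⟩ := W.toSubmodule.exists_add_mem_mem_orthogonal f
  have hfA : f ∈ A := (MvPolynomial.mem_restrictTotalDegree _ _ _).mpr le_rfl
  have hu0 : u = 0 := hK u ⟨hu, by
    have : u = f - w := by rw [hfu]; abel
    rw [this]
    exact A.sub_mem hfA (hWA hw)⟩
  rw [hfu, hu0, add_zero]
  exact LieSubmodule.lieSpan_mono (fun g hg => hg.2) hw

end BraidedCasimir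

namespace BraidedCasimir

/-! ### Gelfand invariants -/

lemma mem_center_of_commute_ι {L : Type*} [LieRing L] [LieAlgebra ℂ L] {z : U L}
    (h : ∀ x : L, Commute (UniversalEnvelopingAlgebra.ι ℂ x) z) : z ∈ Z L := by
  have h1 : (⊤ : Subalgebra ℂ (U L)) ≤ Subalgebra.centralizer ℂ {z} := by
    rw [← adjoin_range_ι, Algebra.adjoin_le_iff]
    rintro _ ⟨x, rfl⟩
    rw [SetLike.mem_coe, Subalgebra.mem_centralizer_iff]
    rintro _ rfl
    exact (h x).eq.symm
  rw [Subalgebra.mem_center_iff]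
  intro b
  have hb := h1 (Algebra.mem_top : b ∈ ⊤)
  rw [Subalgebra.mem_centralizer_iff] at hb
  exact (hb z rfl).symm

/-- The matrix of generators of `U(gl n)`. -/
def genMatrix (n : ℕ) : Matrix (Fin n) (Fin n) (U (gl n)) :=
  Matrix.of fun i j => UniversalEnvelopingAlgebra.ι ℂ (E i j)

lemma genMatrix_apply {n : ℕ} (i j : Fin n) :
    genMatrix n i j = UniversalEnvelopingAlgebra.ι ℂ (E i j) := rfl

/-- Entries of powers transform under the adjoint action as matrix units do, because the
contributions of the contracted index cancel. Hence traces of powers are central. -/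
lemma ι_mul_genMatrix_pow {n : ℕ} (k : ℕ) (a b c d : Fin n) :
    genMatrix n a b * (genMatrix n ^ k) c d =
      (genMatrix n ^ k) c d * genMatrix n a b +
        ((if b = c then (genMatrix n ^ k) a d else 0) -
          if d = a then (genMatrix n ^ k) c b else 0) := by
  induction k generalizing c d with
  | zero =>
    have h1 : genMatrix n a b * (1 : Matrix (Fin n) (Fin n) (U (gl n))) c d =
        (1 : Matrix (Fin n) (Fin n) (U (gl n))) c d * genMatrix n a b := by
      rw [Matrix.one_apply]
      split_ifs <;> simp
    rw [pow_zero, h1, left_eq_add, sub_eq_zero, Matrix.one_apply, Matrix.one_apply]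
    by_cases hbc : b = c <;> by_cases hda : d = a <;> simp [hbc, hda, @eq_comm _ a d, @eq_comm _ c b]
  | succ k ih =>
    have hE : ∀ e, genMatrix n a b * genMatrix n c e = genMatrix n c e * genMatrix n a b +
        ((if b = c then genMatrix n a e else 0) - if e = a then genMatrix n c b else 0) := by
      intro e
      rw [← sub_eq_iff_eq_add', genMatrix_apply, genMatrix_apply, ← LieRing.of_associative_ring_bracket,
        ← LieHom.map_lie, lie_E_E, map_sub, apply_ite (UniversalEnvelopingAlgebra.ι ℂ),
        apply_ite (UniversalEnvelopingAlgebra.ι ℂ), map_zero]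
      rfl
    simp only [pow_succ', Matrix.mul_apply, Finset.mul_sum, Finset.sum_mul]
    simp only [← mul_assoc, hE, add_mul, sub_mul, ite_mul, zero_mul]
    simp only [mul_assoc, ih, mul_add, mul_sub, mul_ite, mul_zero, Finset.sum_add_distrib,
      Finset.sum_sub_distrib, Finset.sum_ite_eq, Finset.sum_ite_eq', Finset.mem_univ, if_true]
    split_ifs <;> (try simp only [Finset.sum_const_zero]) <;> abel

/-- The Gelfand invariants: the traces of the powers of the matrix of generators. -/
def gelfand (n k : ℕ) : Z (gl n) :=
  ⟨(genMatrix n ^ k).trace, mem_center_of_commute_ι fun X => by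
    rw [gl_eq_sum X]
    simp only [map_sum, map_smul]
    refine Commute.sum_left _ _ _ fun a _ => Commute.sum_left _ _ _ fun b _ =>
      Commute.smul_left ?_ _
    rw [commute_iff_eq, ← genMatrix_apply, Matrix.trace, Finset.mul_sum, Finset.sum_mul]
    simp only [Matrix.diag_apply, ι_mul_genMatrix_pow, Finset.sum_add_distrib,
      Finset.sum_sub_distrib, Finset.sum_ite_eq, Finset.sum_ite_eq', Finset.mem_univ, if_true,
      sub_self, add_zero]⟩

/-! ### Eigenvalues of the Gelfand invariants and symmetric polynomials -/

/-- The eigenvalues of the diagonal entries of the powers of the matrix of generators on a highest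
weight vector, in terms of the shifted weight. -/
def gelfandCoef {R : Type*} [CommRing R] {n : ℕ} (l : Fin n → R) : ℕ → Fin n → R
  | 0, _ => 1
  | k + 1, i => l i * gelfandCoef l k i - ∑ j ∈ Finset.Ioi i, gelfandCoef l k j

/-- The shifted weight `μ_i + n - 1 - i`. -/
def shiftWt {n : ℕ} (mu : Fin n → ℂ) (i : Fin n) : ℂ := mu i + ((n : ℂ) - 1 - (i : ℂ))

section

variable {n : ℕ} {M : Type*} [AddCommGroup M] [Module ℂ M] [LieRingModule (gl n) M]
  [LieModule ℂ (gl n) M]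

/-- The `(i, j)` entry is the commutator of `E i j`, which kills `v`, with the `(j, j)` entry, which
acts on `v` by a scalar. -/
lemma genMatrix_pow_lt_of_diag {mu : Fin n → ℂ} {v : M} (hv : IsSingular mu v) {k : ℕ}
    {a : Fin n → ℂ} (ha : ∀ i, uAct (gl n) M ((genMatrix n ^ k) i i) v = a i • v) {i j : Fin n}
    (hij : i < j) : uAct (gl n) M ((genMatrix n ^ k) i j) v = 0 := by
  have h := congrArg (fun y => uAct (gl n) M y v) (ι_mul_genMatrix_pow k i j j j)
  simp only [if_true, hij.ne', if_false, sub_zero, map_add, map_mul, LinearMap.add_apply,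
    Module.End.mul_apply, ha, genMatrix_apply, uAct_ι, hv.2 i j hij, lie_smul, map_zero,
    smul_zero, zero_add] at h
  exact h.symm

/-- In the sum over the inner index `e`, terms with `e < i` vanish and `e = i` gives `mu i`. For `e
> i`, moving the raising operator to the right leaves a difference of diagonal entries; the `n - 1 -
i` such terms produce the shift of the weight. -/
lemma genMatrix_pow_diag {mu : Fin n → ℂ} {v : M} (hv : IsSingular mu v) (k : ℕ) (i : Fin n) :
    uAct (gl n) M ((genMatrix n ^ k) i i) v = gelfandCoef (shiftWt mu) k i • v := by
  induction k generalizing i with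
  | zero => simp [gelfandCoef]
  | succ k ih =>
    have hlow : ∀ e, uAct (gl n) M (genMatrix n i e * (genMatrix n ^ k) e i) v =
        (if e = i then (mu i * gelfandCoef (shiftWt mu) k i) else 0) • v +
        (if e ∈ Finset.Ioi i then (gelfandCoef (shiftWt mu) k i - gelfandCoef (shiftWt mu) k e)
          else 0) • v := by
      intro e
      rcases lt_trichotomy e i with h | h | h
      · rw [map_mul, Module.End.mul_apply, genMatrix_pow_lt_of_diag hv ih h]
        simp [h.ne, h.le]
      · subst h
        rw [map_mul, Module.End.mul_apply, ih, genMatrix_apply, uAct_ι, lie_smul, hv.1]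
        simp [smul_smul, mul_comm]
      · rw [ι_mul_genMatrix_pow, map_add, map_mul, LinearMap.add_apply, Module.End.mul_apply,
          genMatrix_apply, uAct_ι, hv.2 i e h]
        simp [h.ne', h, ih, sub_smul]
    rw [pow_succ', Matrix.mul_apply, map_sum, LinearMap.sum_apply]
    simp only [hlow]
    rw [Finset.sum_add_distrib, ← Finset.sum_smul, ← Finset.sum_smul, ← add_smul]
    congr 1
    rw [Finset.sum_ite_eq' , if_pos (Finset.mem_univ _), Finset.sum_ite_mem, Finset.univ_inter,
      Finset.sum_sub_distrib, Finset.sum_const, Fin.card_Ioi, gelfandCoef, shiftWt, nsmul_eq_mul,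
      Nat.sub_sub, Nat.cast_sub (by omega)]
    push_cast
    ring

lemma uAct_gelfand {mu : Fin n → ℂ} {v : M} (hv : IsSingular mu v) (k : ℕ) :
    uAct (gl n) M (gelfand n k) v = (∑ i, gelfandCoef (shiftWt mu) k i) • v := by
  change uAct (gl n) M (∑ i, (genMatrix n ^ k) i i) v = _
  rw [map_sum, LinearMap.sum_apply, Finset.sum_smul]
  exact Finset.sum_congr rfl fun i _ => genMatrix_pow_diag hv k i

end

/-- The Perelomov–Popov formula; `hw` is the recursion `gelfandCoef` for generating functions in
`s`. The relation at index 0 involves the sum of all later `w`, so splitting off that index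
contributes exactly one factor on each side. -/
lemma prod_one_sub_mul {P : Type*} [CommRing P] (s : P) {n : ℕ} (l w : Fin n → P)
    (hw : ∀ i, w i = 1 + s * (l i * w i - ∑ j ∈ Finset.Ioi i, w j)) :
    (∏ i, (1 - s * l i)) * (1 - s * ∑ i, w i) = ∏ i, (1 - s - s * l i) := by
  induction n with
  | zero => simp
  | succ n ih =>
    have h1 := ih (fun i => l i.succ) (fun i => w i.succ) fun i => by
      rw [← Fin.sum_Ioi_succ]; exact hw i.succ
    have h0 := hw 0
    rw [Fin.sum_Ioi_zero] at h0
    rw [Fin.prod_univ_succ, Fin.prod_univ_succ, Fin.sum_univ_succ, ← h1]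
    linear_combination (-s * ∏ i : Fin n, (1 - s * l i.succ)) * h0

/-- The elementary symmetric functions of a family. -/
def esymmFun {R : Type*} [CommRing R] {n : ℕ} (l : Fin n → R) (k : ℕ) : R :=
  ∑ t ∈ Finset.powersetCard k Finset.univ, ∏ i ∈ t, l i

lemma prod_sub_mul_eq_sum {P : Type*} [CommRing P] (s y : P) {n : ℕ} (l : Fin n → P) :
    ∏ i, (y - s * l i) =
      ∑ j ∈ Finset.range (n + 1), (-1) ^ j * s ^ j * esymmFun l j * y ^ (n - j) := by
  have h : ∀ i, y - s * l i = -(s * l i) + y := fun i => by ring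
  simp only [h]
  rw [Finset.prod_add, Finset.sum_powerset, Finset.card_univ, Fintype.card_fin]
  refine Finset.sum_congr rfl fun j _ => ?_
  rw [esymmFun, Finset.mul_sum, Finset.sum_mul]
  refine Finset.sum_congr rfl fun t ht => ?_
  have htc := (Finset.mem_powersetCard.mp ht).2
  have h2 : ∀ i, -(s * l i) = (-1 * s) * l i := fun i => by ring
  simp only [h2]
  rw [Finset.prod_mul_distrib, Finset.prod_const, Finset.prod_const, htc, mul_pow,
    Finset.card_sdiff_of_subset (Finset.subset_univ _), htc, Finset.card_univ, Fintype.card_fin]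

/-- A subalgebra containing the eigenvalues of the Gelfand invariants contains the elementary
symmetric functions. -/
theorem esymmFun_mem {R : Type*} [CommRing R] [Algebra ℂ R] {n : ℕ} (l : Fin n → R)
    (S : Subalgebra ℂ R) (hS : ∀ k, ∑ i, gelfandCoef l k i ∈ S) (k : ℕ) (hk : k ≤ n) :
    esymmFun l k ∈ S := by
  let w : Fin n → PowerSeries R := fun i => PowerSeries.mk fun k => gelfandCoef l k i
  let l' : Fin n → PowerSeries R := fun i => PowerSeries.C (l i)
  have hw : ∀ i, w i = 1 + PowerSeries.X * (l' i * w i - ∑ j ∈ Finset.Ioi i, w j) := by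
    intro i
    ext k
    rcases k with _ | k
    · simp [w, gelfandCoef]
    · simp [w, l', gelfandCoef, PowerSeries.coeff_succ_X_mul, PowerSeries.coeff_one]
  have h1 := prod_one_sub_mul PowerSeries.X l' w hw
  rw [prod_sub_mul_eq_sum, prod_sub_mul_eq_sum, Finset.sum_mul] at h1
  simp only [one_pow, mul_one] at h1
  rw [← sub_eq_zero, ← Finset.sum_sub_distrib] at h1
  have hes : ∀ j, esymmFun l' j = PowerSeries.C (esymmFun l j) := by
    intro j
    simp [esymmFun, l', map_sum, map_prod]
  -- Expanding both products in elementary symmetric functions `e_j` turns the identity into: the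
  -- sum of `(-X)^j * e_j * B j` is zero. All coefficients of `B j` lie in `S`.
  set B : ℕ → PowerSeries R := fun j =>
    (1 - PowerSeries.X * ∑ i, w i) - (1 - PowerSeries.X) ^ (n - j) with hB
  have hBmem : ∀ j r, PowerSeries.coeff r (B j) ∈ S := by
    intro j r
    rw [hB]
    simp only [map_sub]
    refine sub_mem (sub_mem ?_ ?_) ?_
    · rw [PowerSeries.coeff_one]; split_ifs <;> [exact one_mem _; exact zero_mem _]
    · rcases r with _ | r
      · simp
      · rw [PowerSeries.coeff_succ_X_mul, map_sum]
        simpa [w] using hS r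
    · have : (1 - PowerSeries.X : PowerSeries R) ^ (n - j) =
          PowerSeries.map (algebraMap ℂ R) ((1 - PowerSeries.X) ^ (n - j)) := by simp
      rw [this, PowerSeries.coeff_map]
      exact S.algebraMap_mem _
  have hB0 : ∀ j, PowerSeries.coeff 0 (B j) = 0 := by
    intro j
    simp [hB]
  have hB1 : ∀ j ≤ n, PowerSeries.coeff 1 (B j) = -(j : R) := by
    intro j hj
    have h2 : PowerSeries.coeff 1 ((1 - PowerSeries.X : PowerSeries R) ^ (n - j)) =
        -((n - j : ℕ) : R) := by
      rw [PowerSeries.coeff_one_pow]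
      simp [PowerSeries.coeff_one]
    rw [hB]
    simp only [map_sub]
    rw [h2, PowerSeries.coeff_succ_X_mul, map_sum, Nat.cast_sub hj, PowerSeries.coeff_one]
    simp [w, gelfandCoef]
    ring
  have hsum : ∀ k ≤ n, ∑ j ∈ Finset.range (k + 1),
      (-1) ^ j * esymmFun l j * PowerSeries.coeff (k + 1 - j) (B j) = 0 := by
    intro k hk
    have h2 := congrArg (PowerSeries.coeff (k + 1)) h1
    rw [map_sum, map_zero] at h2
    rw [← h2]
    have h3 : ∀ j, PowerSeries.coeff (k + 1) ((-1) ^ j * PowerSeries.X ^ j * esymmFun l' j *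
        (1 - PowerSeries.X * ∑ i, w i) -
          (-1) ^ j * PowerSeries.X ^ j * esymmFun l' j * (1 - PowerSeries.X) ^ (n - j)) =
        if j ≤ k + 1 then
          (-1) ^ j * esymmFun l j * PowerSeries.coeff (k + 1 - j) (B j) else 0 := by
      intro j
      have h4 : (-1) ^ j * PowerSeries.X ^ j * esymmFun l' j * (1 - PowerSeries.X * ∑ i, w i) -
          (-1) ^ j * PowerSeries.X ^ j * esymmFun l' j * (1 - PowerSeries.X) ^ (n - j) =
          PowerSeries.X ^ j * (PowerSeries.C ((-1) ^ j * esymmFun l j) * B j) := by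
        rw [hes, hB, map_mul, map_pow, map_neg, map_one]
        ring
      rw [h4, PowerSeries.coeff_X_pow_mul', PowerSeries.coeff_C_mul]
    simp only [h3]
    rw [← Finset.sum_subset (Finset.range_mono (Nat.succ_le_succ hk))]
    · refine Finset.sum_congr rfl fun j hj => ?_
      rw [if_pos (Finset.mem_range.mp hj).le]
    · intro j _ hj
      rw [Finset.mem_range, not_lt] at hj
      split_ifs with h
      · rw [le_antisymm h hj, Nat.sub_self, hB0, mul_zero]
      · rfl
  -- As `B j` starts with `-j * X`, the coefficient of `X ^ (k + 1)` expresses `k * e_k` through the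
  -- `e_j` with `j < k`.
  induction k using Nat.strong_induction_on with
  | _ k ih =>
    rcases Nat.eq_zero_or_pos k with rfl | hk0
    · simp [esymmFun]
    · have h2 := hsum k hk
      rw [Finset.sum_range_succ, Nat.add_sub_cancel_left, hB1 k hk] at h2
      have h3 : esymmFun l k = ((k : ℂ)⁻¹ * (-1) ^ k) • ∑ j ∈ Finset.range k,
          (-1) ^ j * esymmFun l j * PowerSeries.coeff (k + 1 - j) (B j) := by
        rw [eq_neg_of_add_eq_zero_left h2]
        have hk1 : (k : ℂ) ≠ 0 := by exact_mod_cast hk0.ne'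
        have h4 : (k : R) = algebraMap ℂ R k := by simp
        have h5 : ((-1 : R)) ^ k = algebraMap ℂ R ((-1) ^ k) := by simp
        rw [h4, h5, Algebra.smul_def]
        have h6 : algebraMap ℂ R ((k : ℂ)⁻¹ * (-1) ^ k) * (algebraMap ℂ R ((-1) ^ k) *
          algebraMap ℂ R k) = 1 := by
          rw [← map_mul, ← map_mul, ← map_one (algebraMap ℂ R)]
          congr 1
          have h7 : ((-1 : ℂ) ^ k) * (-1) ^ k = 1 := by rw [← mul_pow]; simp
          field_simp
          linear_combination h7
        linear_combination (-esymmFun l k) * h6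
      rw [h3]
      refine S.smul_mem (sum_mem fun j hj => ?_) _
      have hjk := Finset.mem_range.mp hj
      exact mul_mem (mul_mem (pow_mem (neg_mem (one_mem _)) _) (ih j hjk (by omega))) (hBmem _ _)

/-- The functions of the shifted weight by which central elements act on highest weight vectors of
the polarization module. -/
def centralCharacters (n : ℕ) : Subalgebra ℂ ((Fin n → ℂ) → ℂ) where
  carrier := {s | ∃ z : Z (gl n), ∀ (mu : Fin n → ℂ) (v : MatPoly n), IsSingular mu v →
    uAct (gl n) (MatPoly n) z v = s (shiftWt mu) • v}
  mul_mem' := by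
    rintro s t ⟨y, hy⟩ ⟨z, hz⟩
    refine ⟨y * z, fun mu v hv => ?_⟩
    rw [Subalgebra.coe_mul, map_mul, Module.End.mul_apply, hz mu v hv, map_smul, hy mu v hv,
      smul_smul, mul_comm]
    rfl
  add_mem' := by
    rintro s t ⟨y, hy⟩ ⟨z, hz⟩
    refine ⟨y + z, fun mu v hv => ?_⟩
    rw [Subalgebra.coe_add, map_add, LinearMap.add_apply, hz mu v hv, hy mu v hv, ← add_smul]
    rfl
  algebraMap_mem' c := ⟨algebraMap ℂ _ c, fun mu v _ => by
    rw [Subalgebra.coe_algebraMap, AlgHom.commutes, Module.algebraMap_end_apply]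
    rfl⟩

lemma eval_mem_subalgebra {σ Y : Type*} (S : Subalgebra ℂ (Y → ℂ)) {f : σ → Y → ℂ}
    (hf : ∀ i, f i ∈ S) (r : MvPolynomial σ ℂ) :
    (fun y => MvPolynomial.eval (fun i => f i y) r) ∈ S := by
  induction r using MvPolynomial.induction_on with
  | C c =>
    simp only [MvPolynomial.eval_C]
    exact S.algebraMap_mem c
  | add p q hp hq =>
    simp only [map_add]
    exact S.add_mem hp hq
  | mul_X p i hp =>
    simp only [map_mul, MvPolynomial.eval_X]
    exact S.mul_mem hp (hf i)

/-- Every symmetric polynomial in the shifted weight is the character of a central element. -/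
theorem exists_central_of_isSymmetric {n : ℕ} {q : MvPolynomial (Fin n) ℂ} (hq : q.IsSymmetric) :
    ∃ z : Z (gl n), ∀ (mu : Fin n → ℂ) (v : MatPoly n), IsSingular mu v →
      uAct (gl n) (MatPoly n) z v = MvPolynomial.eval (shiftWt mu) q • v := by
  suffices h : (fun l => MvPolynomial.eval l q) ∈ centralCharacters n from h
  have hes : ∀ k ≤ n, (fun l => MvPolynomial.eval l (MvPolynomial.esymm (Fin n) ℂ k)) ∈
      centralCharacters n := by
    intro k hk
    -- The recursion is run in the ring of functions of `l`, so that one central element serves all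
    -- weights.
    have hg : ∀ k (l : Fin n → ℂ) i, gelfandCoef (fun (i : Fin n) (l : Fin n → ℂ) => l i) k i l =
        gelfandCoef l k i := by
      intro k l
      induction k with
      | zero => intro i; rfl
      | succ k ih => intro i; simp [gelfandCoef, ih]
    have h := esymmFun_mem (fun (i : Fin n) (l : Fin n → ℂ) => l i) (centralCharacters n)
      (fun k => ⟨gelfand n k, fun mu v hv => by
        rw [uAct_gelfand hv]
        congr 1
        rw [Finset.sum_apply]
        simp only [hg]⟩) k hk
    convert h using 1
    ext l
    simp [MvPolynomial.esymm, esymmFun]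
  obtain ⟨r, hr⟩ := MvPolynomial.esymmAlgHom_surjective (σ := Fin n) ℂ (n := n) (by simp)
    ⟨q, hq⟩
  have hr' : q = MvPolynomial.aeval (fun i : Fin n => MvPolynomial.esymm (Fin n) ℂ (i + 1)) r := by
    rw [← MvPolynomial.esymmAlgHom_apply, hr]
  have h2 : (fun l => MvPolynomial.eval l q) = fun l => MvPolynomial.eval
      (fun i : Fin n => MvPolynomial.eval l (MvPolynomial.esymm (Fin n) ℂ (i + 1))) r := by
    ext l
    rw [hr']
    exact MvPolynomial.comp_aeval_apply _ (MvPolynomial.aeval l) r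
  rw [h2]
  exact eval_mem_subalgebra _ (fun i : Fin n => hes (i + 1) i.2) r

end BraidedCasimir

namespace BraidedCasimir

/-! ### Weights of an irreducible module and their symmetry -/

/-- Conjugation by the exponential of a nilpotent element, when its adjoint action on the element
conjugated has vanishing cube. -/
lemma exists_unit_exp_conj {A : Type*} [Ring A] [Algebra ℂ A] {N : A} (hN : IsNilpotent N) :
    ∃ u : Aˣ, ∀ Y Z W : A, ⁅N, Y⁆ = Z → ⁅N, Z⁆ = W → ⁅N, W⁆ = 0 →
      u * Y = (Y + Z + (2⁻¹ : ℂ) • W) * u := by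
  let _ : Module ℚ A := Module.compHom A (algebraMap ℚ ℂ)
  have : IsScalarTower ℚ ℂ A := ⟨fun q c a => by
    rw [Algebra.smul_def q c, mul_smul]; rfl⟩
  have : SMulCommClass ℂ ℚ A := ⟨fun c q a => smul_comm c (algebraMap ℚ ℂ q) a⟩
  refine ⟨⟨IsNilpotent.exp N, IsNilpotent.exp (-N), IsNilpotent.exp_mul_exp_neg_self hN,
    IsNilpotent.exp_neg_mul_exp_self hN⟩, fun Y Z W hZ hW h0 => ?_⟩
  have hL : IsNilpotent (LinearMap.mulLeft ℂ N) := by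
    obtain ⟨k, hk⟩ := hN
    exact ⟨k, by rw [LinearMap.pow_mulLeft, hk, LinearMap.mulLeft_zero_eq_zero]⟩
  have hR : IsNilpotent (LinearMap.mulRight ℂ (-N)) := by
    obtain ⟨k, hk⟩ := hN.neg
    exact ⟨k, by rw [LinearMap.pow_mulRight, hk, LinearMap.mulRight_zero_eq_zero]⟩
  have hLR := LinearMap.commute_mulLeft_right (R := ℂ) N (-N)
  -- `D` is `ad N`, a sum of commuting nilpotents, so its exponential is conjugation by that of `N`;
  -- on `Y` the series stops after the quadratic term.
  set D := LinearMap.mulLeft ℂ N + LinearMap.mulRight ℂ (-N) with hD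
  have hDapp : ∀ y, D y = ⁅N, y⁆ := fun y => by
    rw [hD, LinearMap.add_apply, LinearMap.mulLeft_apply, LinearMap.mulRight_apply, mul_neg,
      ← sub_eq_add_neg, LieRing.of_associative_ring_bracket]
  have hDn : IsNilpotent D := hLR.isNilpotent_add hL hR
  have h1 : IsNilpotent.exp D Y = IsNilpotent.exp N * (Y * IsNilpotent.exp (-N)) := by
    rw [hD, IsNilpotent.exp_add_of_commute hLR hL hR, Module.End.mul_apply]
    obtain ⟨k, hk⟩ := hN
    obtain ⟨m, hm⟩ := IsNilpotent.neg (x := N) ⟨k, hk⟩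
    have e1 : IsNilpotent.exp (LinearMap.mulLeft ℂ N) = LinearMap.mulLeft ℂ (IsNilpotent.exp N) := by
      ext y
      rw [IsNilpotent.exp_eq_sum hk, IsNilpotent.exp_eq_sum (k := k)
        (by rw [LinearMap.pow_mulLeft, hk, LinearMap.mulLeft_zero_eq_zero])]
      simp only [LinearMap.pow_mulLeft, LinearMap.sum_apply, LinearMap.smul_apply,
        LinearMap.mulLeft_apply, Finset.sum_mul]
      exact Finset.sum_congr rfl fun i _ => (smul_mul_assoc (((i.factorial : ℚ)⁻¹ : ℚ) : ℂ) _ _).symm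
    have e2 : IsNilpotent.exp (LinearMap.mulRight ℂ (-N)) =
        LinearMap.mulRight ℂ (IsNilpotent.exp (-N)) := by
      ext y
      rw [IsNilpotent.exp_eq_sum hm, IsNilpotent.exp_eq_sum (k := m)
        (by rw [LinearMap.pow_mulRight, hm, LinearMap.mulRight_zero_eq_zero])]
      simp only [LinearMap.pow_mulRight, LinearMap.sum_apply, LinearMap.smul_apply,
        LinearMap.mulRight_apply, Finset.mul_sum]
      exact Finset.sum_congr rfl fun i _ => (mul_smul_comm (((i.factorial : ℚ)⁻¹ : ℚ) : ℂ) _ _).symm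
    rw [e1, e2]
    rfl
  have h2 : IsNilpotent.exp D Y = Y + Z + (2⁻¹ : ℂ) • W := by
    have hD3 : (D ^ 3) • Y = 0 := by
      rw [Module.End.smul_def, pow_succ', pow_two, Module.End.mul_apply, Module.End.mul_apply, hDapp Y, hZ, hDapp Z,
        hW, hDapp, h0]
    have h3 := IsNilpotent.exp_smul_eq_sum hD3 hDn
    rw [Module.End.smul_def] at h3
    rw [h3, Finset.sum_range_succ, Finset.sum_range_succ, Finset.sum_range_one]
    simp only [pow_zero, pow_one, Module.End.smul_def, pow_two, Module.End.mul_apply, hDapp,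
      hZ, hW, Nat.factorial_zero, Nat.factorial_one, Nat.factorial_two, Nat.cast_one, inv_one,
      one_smul]
    congr 1
    have : algebraMap ℚ ℂ ((2 : ℕ) : ℚ)⁻¹ = (2⁻¹ : ℂ) := by simp
    exact congrArg (fun c : ℂ => c • W) this
  show IsNilpotent.exp N * Y = _ * IsNilpotent.exp N
  rw [← h2, h1, mul_assoc, mul_assoc, IsNilpotent.exp_neg_mul_exp_self hN, mul_one]

/-- An endomorphism of a finite-dimensional space that is an eigenvector with nonzero eigenvalue for
the commutator with another one is nilpotent. -/
lemma isNilpotent_of_lie_eq_smul {V : Type*} [AddCommGroup V] [Module ℂ V] [FiniteDimensional ℂ V]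
    {H N : Module.End ℂ V} {c : ℂ} (hc : c ≠ 0) (h : ⁅H, N⁆ = c • N) : IsNilpotent N := by
  by_contra hN
  have hpow : ∀ k : ℕ, ⁅H, N ^ k⁆ = ((k : ℂ) * c) • N ^ k := by
    intro k
    induction k with
    | zero => simp [LieRing.of_associative_ring_bracket]
    | succ k ih =>
      rw [LieRing.of_associative_ring_bracket] at ih h ⊢
      have : H * N ^ (k + 1) - N ^ (k + 1) * H =
          (H * N ^ k - N ^ k * H) * N + N ^ k * (H * N - N * H) := by
        rw [pow_succ]; noncomm_ring
      rw [this, ih, h, smul_mul_assoc, mul_smul_comm, ← pow_succ, ← add_smul]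
      congr 1
      push_cast; ring
  -- If no power of `N` vanished, they would give infinitely many eigenvalues `k * c` of `ad H`.
  have hfin := (LieAlgebra.ad ℂ (Module.End ℂ V) H).finite_hasEigenvalue
  refine Set.infinite_of_injective_forall_mem (f := fun k : ℕ => (k : ℂ) * c) ?_ (fun k => ?_) hfin
  · intro a b hab
    exact_mod_cast mul_right_cancel₀ hc hab
  · exact Module.End.hasEigenvalue_of_hasEigenvector
      ⟨Module.End.mem_eigenspace_iff.mpr (hpow k), fun h0 => hN ⟨k, h0⟩⟩

/-- The exponential of the image of `c • E i j` lifts a transvection to `V`. As `E i j` squares to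
zero, the quadratic truncation of its adjoint exponential is exactly conjugation by `1 + c • E i j`.
-/
lemma exists_unit_transvection {n : ℕ} (V : Type*) [AddCommGroup V] [Module ℂ V]
    [LieRingModule (gl n) V] [LieModule ℂ (gl n) V] [FiniteDimensional ℂ V] {i j : Fin n}
    (hij : i ≠ j) (c : ℂ) :
    ∃ u : (Module.End ℂ V)ˣ, ∀ X : gl n, u * LieModule.toEnd ℂ (gl n) V X =
      LieModule.toEnd ℂ (gl n) V ((1 + c • E i j) * X * (1 - c • E i j)) * u := by
  have hE : (E i j : gl n) * E i j = 0 := by simp [E, hij.symm]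
  have hN : IsNilpotent (LieModule.toEnd ℂ (gl n) V (c • E i j)) := by
    refine isNilpotent_of_lie_eq_smul (H := LieModule.toEnd ℂ (gl n) V (E i i)) one_ne_zero ?_
    rw [← LieHom.map_lie, lie_smul, lie_E_E]
    simp [hij.symm]
  obtain ⟨u, hu⟩ := exists_unit_exp_conj hN
  refine ⟨u, fun X => ?_⟩
  rw [hu _ _ _ (LieHom.map_lie _ _ _).symm (LieHom.map_lie _ _ _).symm]
  all_goals
    set e := c • E i j with he
    have hee : e * e = 0 := by rw [he, smul_mul_smul_comm, hE, smul_zero]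
    have h0 : e * (e * X - X * e) - (e * X - X * e) * e = (2 : ℂ) • (- (e * X * e)) := by
      have : e * (e * X - X * e) - (e * X - X * e) * e =
        (e * e) * X - (e * X * e + e * X * e) + X * (e * e) := by noncomm_ring
      rw [this, hee, two_smul]; noncomm_ring
  · congr 1
    rw [← map_add, ← map_smul, ← map_add]
    congr 1
    simp only [Ring.lie_def]
    rw [h0, smul_smul]
    norm_num
    noncomm_ring
  · rw [← LieHom.map_lie, Ring.lie_def, Ring.lie_def, Ring.lie_def, h0, mul_smul_comm (2 : ℂ),
      smul_mul_assoc (2 : ℂ), ← smul_sub]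
    have : e * -(e * X * e) - -(e * X * e) * e = -((e * e) * X * e) + e * X * (e * e) := by
      noncomm_ring
    rw [this, hee]
    simp only [zero_mul, mul_zero, neg_zero, add_zero, smul_zero, map_zero]

/-- The triple product of transvections is the permutation matrix of the swap up to a sign, which
disappears on diagonal units. -/
lemma perm_conj {n : ℕ} {i j : Fin n} (hij : i ≠ j) (a : Fin n) :
    (1 + E i j) * (1 - E j i) * (1 + E i j) * E a a * ((1 - E i j) * (1 + E j i) * (1 - E i j)) =
      E (Equiv.swap i j a) (Equiv.swap i j a) := by
  have e1 : (E i j : gl n) * E i j = 0 := by simp [E, hij.symm]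
  have e2 : (E j i : gl n) * E j i = 0 := by simp [E, hij]
  have u1 : (1 + E i j : gl n) * (1 - E i j) = 1 := by
    rw [add_mul, mul_sub, mul_sub, e1]; simp
  have u2 : (1 - E j i : gl n) * (1 + E j i) = 1 := by
    rw [sub_mul, mul_add, mul_add, e2]; simp
  have hw : (1 + E i j : gl n) * (1 - E j i) * (1 + E i j) * ((1 - E i j) * (1 + E j i) *
      (1 - E i j)) = 1 := by
    calc _ = (1 + E i j : gl n) * ((1 - E j i) * ((1 + E i j) * (1 - E i j)) * (1 + E j i)) *
        (1 - E i j) := by simp only [mul_assoc]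
      _ = 1 := by rw [u1, mul_one, u2, mul_one, u1]
  have hs : (1 + E i j : gl n) * (1 - E j i) * (1 + E i j) =
      1 + E i j - E j i - E j j - E i i := by
    simp [mul_add, mul_sub, add_mul, sub_mul, hij.symm]
    abel
  have hc : (1 + E i j : gl n) * (1 - E j i) * (1 + E i j) * E a a =
      E (Equiv.swap i j a) (Equiv.swap i j a) * ((1 + E i j) * (1 - E j i) * (1 + E i j)) := by
    rw [hs]
    by_cases hai : a = i
    · subst hai
      simp [mul_add, mul_sub, add_mul, sub_mul, hij.symm]
    · by_cases haj : a = j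
      · subst haj
        simp [mul_add, mul_sub, add_mul, sub_mul, hij]
      · rw [Equiv.swap_apply_of_ne_of_ne hai haj]
        simp [mul_add, mul_sub, add_mul, sub_mul, hai, haj, Ne.symm hai, Ne.symm haj]
  rw [hc, mul_assoc, hw, mul_one]

/-- Permutations of the diagonal matrix units are realized by conjugation on every
finite-dimensional module. -/
lemma exists_unit_perm {n : ℕ} (V : Type*) [AddCommGroup V] [Module ℂ V]
    [LieRingModule (gl n) V] [LieModule ℂ (gl n) V] [FiniteDimensional ℂ V]
    (σ : Equiv.Perm (Fin n)) :
    ∃ u : (Module.End ℂ V)ˣ, ∀ a, u * LieModule.toEnd ℂ (gl n) V (E a a) =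
      LieModule.toEnd ℂ (gl n) V (E (σ a) (σ a)) * u := by
  induction σ using Equiv.Perm.swap_induction_on with
  | one => exact ⟨1, fun a => by simp⟩
  | swap_mul σ i j hij ih =>
    obtain ⟨u, hu⟩ := ih
    obtain ⟨x, hx⟩ := exists_unit_transvection V hij 1
    obtain ⟨y, hy⟩ := exists_unit_transvection V hij.symm (-1)
    refine ⟨x * y * x * u, fun a => ?_⟩
    rw [Units.val_mul, mul_assoc, hu, ← mul_assoc]
    rw [Equiv.Perm.mul_apply, ← mul_assoc]
    congr 1
    generalize σ a = a
    simp only [Units.val_mul]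
    have h1 : (x * y * x : Module.End ℂ V) * LieModule.toEnd ℂ (gl n) V (E a a) =
        x * (y * (x * LieModule.toEnd ℂ (gl n) V (E a a))) := by simp only [mul_assoc]
    rw [h1, hx, ← mul_assoc (y : Module.End ℂ V), hy, ← mul_assoc, ← mul_assoc, hx, mul_assoc,
      mul_assoc, ← mul_assoc (x : Module.End ℂ V)]
    congr 2
    have h := perm_conj hij a
    simp only [one_smul, neg_smul, sub_neg_eq_add, ← sub_eq_add_neg]
    simp only [mul_assoc] at h ⊢
    exact h

lemma eq_top_of_mem {L V : Type*} [LieRing L] [LieAlgebra ℂ L] [AddCommGroup V] [Module ℂ V]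
    [LieRingModule L V] [LieModule.IsIrreducible ℂ L V] (N : LieSubmodule ℂ L V) {v : V}
    (hv : v ∈ N) (hv0 : v ≠ 0) : N = ⊤ :=
  (IsSimpleOrder.eq_bot_or_eq_top N).resolve_left fun h => hv0 (by simpa [h] using hv)

variable {n : ℕ} {V : Type*} [AddCommGroup V] [Module ℂ V] [LieRingModule (gl n) V]
  [LieModule ℂ (gl n) V]

lemma lie_lie_E_of_weight {nu : Fin n → ℂ} {v : V} (hv : ∀ a, ⁅E a a, v⁆ = nu a • v)
    (i j a : Fin n) : ⁅E a a, ⁅E i j, v⁆⁆ =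
      (nu a + ((if a = i then 1 else 0) - if a = j then 1 else 0)) • ⁅E i j, v⁆ := by
  have h : ⁅E a a, E i j⁆ =
      (((if a = i then 1 else 0) - if a = j then 1 else 0) : ℂ) • (E i j : gl n) := by
    rw [lie_E_E, sub_smul, ite_smul, ite_smul, one_smul, zero_smul]
    congr 1
    · split_ifs with h <;> simp [h]
    · by_cases h : j = a
      · simp [h]
      · simp [h, Ne.symm h]
  rw [leibniz_lie, hv, lie_smul, h, smul_lie, ← add_smul, add_comm]

/-! ### Weight bases and the symmetric characteristic polynomial -/

/-- A basis of weight vectors, with the weights and their depths below a fixed height. -/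
structure WeightBasis (n : ℕ) (V : Type*) [AddCommGroup V] [Module ℂ V]
    [LieRingModule (gl n) V] [LieModule ℂ (gl n) V] where
  basis : Module.Basis (Fin (Module.finrank ℂ V)) ℂ V
  wt : Fin (Module.finrank ℂ V) → Fin n → ℂ
  depth : Fin (Module.finrank ℂ V) → ℤ
  base : ℂ
  lie_basis : ∀ k i, ⁅E i i, basis k⁆ = wt k i • basis k
  sum_wt : ∀ k, ∑ i : Fin n, (i : ℂ) * wt k i = base + depth k

lemma IsIrrepOfHighestWeight.nonempty_weightBasis {lam : Fin n → ℂ}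
    (hV : IsIrrepOfHighestWeight V lam) : Nonempty (WeightBasis n V) := by
  have := hV.finiteDimensional
  have := hV.irreducible
  obtain ⟨v₀, hv₀, hw, -⟩ := hV.highestWeight
  set c := ∑ i : Fin n, (i : ℂ) * lam i with hc
  -- Weight vectors at integral height from `lam` span a submodule containing `v₀`, hence everything
  -- by irreducibility. Integral depth permits the later induction.
  set S : Set V := {v | ∃ (nu : Fin n → ℂ) (z : ℤ), (∀ i, ⁅E i i, v⁆ = nu i • v) ∧
    ∑ i : Fin n, (i : ℂ) * nu i = c + z} with hS
  have hlie : ∀ i j : Fin n, ∀ v ∈ S, ⁅E i j, v⁆ ∈ S := by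
    rintro i j v ⟨nu, z, h1, h2⟩
    refine ⟨fun a => nu a + ((if a = i then 1 else 0) - if a = j then 1 else 0), z + (i - j),
      fun a => ?_, ?_⟩
    · exact lie_lie_E_of_weight h1 i j a
    · simp only [mul_add, mul_sub, Finset.sum_add_distrib, Finset.sum_sub_distrib, h2, mul_ite,
        mul_one, mul_zero, Finset.sum_ite_eq', Finset.mem_univ, if_true]
      push_cast; ring
  let N : LieSubmodule ℂ (gl n) V :=
    { Submodule.span ℂ S with
      lie_mem := fun {X v} hv => by
        rw [gl_eq_sum X]
        simp only [sum_lie, smul_lie]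
        refine Submodule.sum_mem _ fun i _ => Submodule.sum_mem _ fun j _ =>
          Submodule.smul_mem _ _ ?_
        have h1 : Submodule.span ℂ S ≤ (Submodule.span ℂ S).comap
            (LieModule.toEnd ℂ (gl n) V (E i j)) :=
          Submodule.span_le.mpr fun w hw => Submodule.subset_span (hlie i j w hw)
        exact h1 hv }
  have hN : N = ⊤ := eq_top_of_mem N (Submodule.subset_span ⟨lam, 0, hw, by simp [hc]⟩) hv₀
  have hspan : ⊤ ≤ Submodule.span ℂ S := by
    have := congrArg LieSubmodule.toSubmodule hN
    exact this.ge
  let b := Module.Basis.ofSpan hspan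
  have := Module.Finite.finite_basis b
  have := Fintype.ofFinite ((linearIndepOn_empty ℂ id).extend (Set.empty_subset S))
  let e := Fintype.equivFinOfCardEq (Module.finrank_eq_card_basis b).symm
  have hb : ∀ k, b.reindex e k ∈ S := fun k => by
    rw [Module.Basis.reindex_apply]
    exact Module.Basis.ofSpan_subset hspan ⟨_, rfl⟩
  choose wt dep h1 h2 using hb
  exact ⟨⟨b.reindex e, wt, dep, c, h1, h2⟩⟩

namespace WeightBasis

variable (B : WeightBasis n V)

lemma repr_lie (i : Fin n) (w : V) (k : Fin (Module.finrank ℂ V)) :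
    B.basis.repr ⁅E i i, w⁆ k = B.wt k i * B.basis.repr w k := by
  have h : (B.basis.coord k).comp (LieModule.toEnd ℂ (gl n) V (E i i)) =
      B.wt k i • B.basis.coord k := by
    refine B.basis.ext fun k' => ?_
    simp only [LinearMap.comp_apply, LieModule.toEnd_apply_apply, B.lie_basis, map_smul,
      LinearMap.smul_apply, Module.Basis.coord_apply, Module.Basis.repr_self, smul_eq_mul]
    by_cases hk : k' = k
    · simp [hk]
    · simp [Finsupp.single_eq_of_ne' hk]
  exact LinearMap.congr_fun h w

lemma wt_eq_of_repr_ne_zero {w : V} {nu : Fin n → ℂ} (hw : ∀ i, ⁅E i i, w⁆ = nu i • w)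
    {k : Fin (Module.finrank ℂ V)} (hk : B.basis.repr w k ≠ 0) : B.wt k = nu := by
  funext i
  have h := B.repr_lie i w k
  rw [hw, map_smul, Finsupp.smul_apply, smul_eq_mul] at h
  exact (mul_right_cancel₀ hk h).symm

lemma depth_lt_of_repr_ne_zero {i j : Fin n} (hij : i < j) {k k' : Fin (Module.finrank ℂ V)}
    (hk : B.basis.repr ⁅E i j, B.basis k⁆ k' ≠ 0) : B.depth k' < B.depth k := by
  have h1 := B.wt_eq_of_repr_ne_zero (nu := fun a => B.wt k a +
      ((if a = i then 1 else 0) - if a = j then 1 else 0)) (lie_lie_E_of_weight (B.lie_basis k) i j) hk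
  have h2 := B.sum_wt k'
  rw [h1] at h2
  simp only [mul_add, mul_sub, Finset.sum_add_distrib, Finset.sum_sub_distrib, B.sum_wt, mul_ite,
    mul_one, mul_zero, Finset.sum_ite_eq', Finset.mem_univ, if_true] at h2
  have h3 : B.depth k + ((i : ℤ) - (j : ℤ)) = B.depth k' := by
    have : ((B.depth k + ((i : ℤ) - (j : ℤ)) : ℤ) : ℂ) = (B.depth k' : ℤ) := by
      push_cast
      linear_combination h2
    exact_mod_cast this
  have : (i : ℕ) < (j : ℕ) := hij
  omega

end WeightBasis

/-- The hypothesis says that `T` intertwines the two diagonal matrices, so they are conjugate. This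
avoids comparing weight multiplicities. -/
lemma charpoly_diagonal_eq_of_unit {ι R : Type*} [Fintype ι] [DecidableEq ι] [CommRing R]
    [Algebra ℂ R] (T : (Matrix ι ι ℂ)ˣ) (d d' : ι → R)
    (h : ∀ k k', (T : Matrix ι ι ℂ) k k' ≠ 0 → d k = d' k') :
    (Matrix.diagonal d).charpoly = (Matrix.diagonal d').charpoly := by
  let T' : (Matrix ι ι R)ˣ := Units.map (algebraMap ℂ R).mapMatrix.toMonoidHom T
  have hT : ∀ k k', (T' : Matrix ι ι R) k k' = algebraMap ℂ R ((T : Matrix ι ι ℂ) k k') :=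
    fun _ _ => rfl
  rw [← Matrix.charpoly_units_conj T' (Matrix.diagonal d')]
  congr 1
  rw [eq_comm, ← Matrix.coe_units_inv, Units.mul_inv_eq_iff_eq_mul]
  ext k k'
  rw [Matrix.mul_diagonal, Matrix.diagonal_mul, hT, mul_comm]
  by_cases h0 : (T : Matrix ι ι ℂ) k k' = 0
  · simp [h0]
  · rw [h k k' h0]

namespace WeightBasis

variable (B : WeightBasis n V)

/-- The universal characteristic polynomial attached to a family of weights and a function on
weights. -/
def charPoly (κ : (Fin n → ℂ) → ℂ) : Polynomial (MvPolynomial (Fin n) ℂ) :=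
  ∏ k, (Polynomial.X - Polynomial.C
    (∑ i, MvPolynomial.C (B.wt k i) * MvPolynomial.X i + MvPolynomial.C (κ (B.wt k))))

/-- The entries of the diagonal matrix whose characteristic polynomial is `charPoly`. -/
def charEntry (κ : (Fin n → ℂ) → ℂ) (k : Fin (Module.finrank ℂ V)) : MvPolynomial (Fin n) ℂ :=
  ∑ i, MvPolynomial.C (B.wt k i) * MvPolynomial.X i + MvPolynomial.C (κ (B.wt k))

lemma charPoly_eq (κ : (Fin n → ℂ) → ℂ) :
    B.charPoly κ = (Matrix.diagonal (B.charEntry κ)).charpoly := by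
  rw [Matrix.charpoly_diagonal]
  rfl

lemma charPoly_map_rename (κ : (Fin n → ℂ) → ℂ) (σ : Equiv.Perm (Fin n)) :
    (B.charPoly κ).map (MvPolynomial.rename σ : MvPolynomial (Fin n) ℂ →ₐ[ℂ]
      MvPolynomial (Fin n) ℂ).toRingHom =
      (Matrix.diagonal fun k => MvPolynomial.rename σ (B.charEntry κ k)).charpoly := by
  rw [Matrix.charpoly_diagonal, charPoly, Polynomial.map_prod]
  simp only [Polynomial.map_sub, Polynomial.map_X, Polynomial.map_C]
  rfl

/-- The operator lifting `σ` carries vectors of weight `ν` to weight `ν ∘ σ⁻¹`, so renaming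
variables gives a conjugate diagonal matrix. -/
lemma coeff_charPoly_isSymmetric [FiniteDimensional ℂ V] {κ : (Fin n → ℂ) → ℂ}
    (hκ : ∀ (nu : Fin n → ℂ) (σ : Equiv.Perm (Fin n)), κ (nu ∘ σ) = κ nu) (d : ℕ) :
    ((B.charPoly κ).coeff d).IsSymmetric := by
  intro σ
  have hcoe : MvPolynomial.rename σ ((B.charPoly κ).coeff d) =
      ((B.charPoly κ).map (MvPolynomial.rename σ : MvPolynomial (Fin n) ℂ →ₐ[ℂ]
        MvPolynomial (Fin n) ℂ).toRingHom).coeff d := by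
    rw [Polynomial.coeff_map]; rfl
  rw [hcoe, charPoly_map_rename, charPoly_eq]
  congr 1
  obtain ⟨u, hu⟩ := exists_unit_perm V σ
  refine (charpoly_diagonal_eq_of_unit
    (Units.map (LinearMap.toMatrixAlgEquiv B.basis).toMulEquiv.toMonoidHom u) _ _
    fun k k' h0 => ?_).symm
  replace h0 : B.basis.repr ((u : Module.End ℂ V) (B.basis k')) k ≠ 0 := by
    rw [← LinearMap.toMatrixAlgEquiv_apply]
    exact h0
  have h3 : B.wt k = B.wt k' ∘ σ.symm := by
    refine B.wt_eq_of_repr_ne_zero (fun i => ?_) h0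
    have h4 := LinearMap.congr_fun (hu (σ.symm i)) (B.basis k')
    rw [Module.End.mul_apply, Module.End.mul_apply, LieModule.toEnd_apply_apply,
      LieModule.toEnd_apply_apply, B.lie_basis, map_smul, Equiv.apply_symm_apply] at h4
    exact h4.symm
  simp only [charEntry, h3, hκ, map_add, map_sum, map_mul, MvPolynomial.rename_C,
    MvPolynomial.rename_X]
  congr 1
  rw [← Equiv.sum_comp σ]
  simp

end WeightBasis

end BraidedCasimir

namespace BraidedCasimir

/-! ### The action of the braided Casimir element on tensor products -/

section Equivariant

variable {L M : Type*} [LieRing L] [AddCommGroup M] [Module ℂ M] [LieRingModule L M]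

lemma map_mem_of_mem_lieSpan {T : Module.End ℂ M} (hT : ∀ (X : L) m, T ⁅X, m⁆ = ⁅X, T m⁆)
    {S : Set M} {N : LieSubmodule ℂ L M} (hS : ∀ m ∈ S, T m ∈ N) {m : M}
    (hm : m ∈ LieSubmodule.lieSpan ℂ L S) : T m ∈ N := by
  let T' : M →ₗ⁅ℂ, L⁆ M := { T with map_lie' := fun {X m} => hT X m }
  have h : LieSubmodule.lieSpan ℂ L S ≤ N.comap T' := LieSubmodule.lieSpan_le.mpr hS
  exact h hm

/-- The kernel of the equivariant map `T - c` is a submodule. This takes the place of Schur's lemma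
throughout. -/
lemma eq_smul_of_mem_lieSpan [LieAlgebra ℂ L] [LieModule ℂ L M] {T : Module.End ℂ M}
    (hT : ∀ (X : L) m, T ⁅X, m⁆ = ⁅X, T m⁆) {c : ℂ} {S : Set M} (hS : ∀ m ∈ S, T m = c • m) {m : M}
    (hm : m ∈ LieSubmodule.lieSpan ℂ L S) : T m = c • m := by
  have h := map_mem_of_mem_lieSpan (T := T - c • 1) (N := ⊥) (L := L) (fun X m => by
    simp [hT]) (S := S) (fun m hm => by simp [hS m hm]) hm
  rwa [LieSubmodule.mem_bot, LinearMap.sub_apply, sub_eq_zero] at h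

lemma uAct_center_lie [LieAlgebra ℂ L] [LieModule ℂ L M] (z : Z L) (X : L) (m : M) :
    uAct L M z ⁅X, m⁆ = ⁅X, uAct L M z m⁆ := by
  have h := (Subalgebra.mem_center_iff.mp z.2) (UniversalEnvelopingAlgebra.ι ℂ X)
  have h1 := LinearMap.congr_fun (congrArg (uAct L M) h) m
  rw [map_mul, map_mul, Module.End.mul_apply, Module.End.mul_apply, uAct_ι, uAct_ι] at h1
  exact h1.symm

lemma aeval_lie [LieAlgebra ℂ L] [LieModule ℂ L M] {T : Module.End ℂ M}
    (hT : ∀ (X : L) m, T ⁅X, m⁆ = ⁅X, T m⁆) (q : Polynomial ℂ) (X : L) (m : M) :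
    Polynomial.aeval T q ⁅X, m⁆ = ⁅X, Polynomial.aeval T q m⁆ := by
  induction q using Polynomial.induction_on generalizing m with
  | C c => simp
  | add p q hp hq => simp [hp, hq]
  | monomial k c ih =>
    rw [pow_succ, ← mul_assoc, map_mul, Module.End.mul_apply, Module.End.mul_apply,
      Polynomial.aeval_X, hT, ih]

lemma aeval_mem {T : Module.End ℂ M} {N : Submodule ℂ M}
    (hT : ∀ m ∈ N, T m ∈ N)
    (q : Polynomial ℂ) {m : M} (hm : m ∈ N) : Polynomial.aeval T q m ∈ N := by
  induction q using Polynomial.induction_on generalizing m with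
  | C c => simpa using N.smul_mem c hm
  | add p q hp hq => simpa using add_mem (hp hm) (hq hm)
  | monomial k c ih =>
    rw [pow_succ, ← mul_assoc, map_mul, Module.End.mul_apply, Polynomial.aeval_X]
    exact ih (hT m hm)

end Equivariant

lemma lie_lie_E_E {n : ℕ} {M : Type*} [AddCommGroup M] [LieRingModule (gl n) M] (i j a b : Fin n)
    (m : M) : ⁅E a b, ⁅E i j, m⁆⁆ = ⁅E i j, ⁅E a b, m⁆⁆ +
    ((if b = i then ⁅E a j, m⁆ else 0) - if j = a then ⁅E i b, m⁆ else 0) := by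
  rw [leibniz_lie, lie_E_E, sub_lie, add_comm]
  congr 2 <;> split_ifs <;> simp

section

variable {n : ℕ} {M V : Type*} [AddCommGroup M] [Module ℂ M] [LieRingModule (gl n) M]
  [LieModule ℂ (gl n) M] [AddCommGroup V] [Module ℂ V] [LieRingModule (gl n) V]
  [LieModule ℂ (gl n) V]

/-- The action of the braided Casimir element on a tensor product of modules. -/
def omegaAct (n : ℕ) (M V : Type*) [AddCommGroup M] [Module ℂ M] [LieRingModule (gl n) M]
    [LieModule ℂ (gl n) M] [AddCommGroup V] [Module ℂ V] [LieRingModule (gl n) V]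
    [LieModule ℂ (gl n) V] : Module.End ℂ (M ⊗[ℂ] V) :=
  ∑ i : Fin n, ∑ j : Fin n, TensorProduct.map (LieModule.toEnd ℂ (gl n) M (E i j))
    (LieModule.toEnd ℂ (gl n) V (E j i))

lemma omegaAct_tmul (m : M) (v : V) :
    omegaAct n M V (m ⊗ₜ v) = ∑ i : Fin n, ∑ j : Fin n, ⁅E i j, m⁆ ⊗ₜ[ℂ] ⁅E j i, v⁆ := by
  simp [omegaAct, LinearMap.sum_apply]

lemma omegaAct_lie (X : gl n) (w : M ⊗[ℂ] V) :
    omegaAct n M V ⁅X, w⁆ = ⁅X, omegaAct n M V w⁆ := by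
  induction w using TensorProduct.induction_on with
  | zero => simp
  | add w w' h h' => simp only [lie_add, map_add, h, h']
  | tmul m v =>
    rw [gl_eq_sum X]
    simp only [sum_lie, smul_lie, map_sum, map_smul]
    refine Finset.sum_congr rfl fun a _ => Finset.sum_congr rfl fun b _ => ?_
    congr 1
    rw [TensorProduct.LieModule.lie_tmul_right, map_add, omegaAct_tmul, omegaAct_tmul,
      omegaAct_tmul, lie_sum]
    simp only [lie_sum, TensorProduct.LieModule.lie_tmul_right, lie_lie_E_E _ _ a b, TensorProduct.add_tmul,
      TensorProduct.tmul_add, TensorProduct.sub_tmul, TensorProduct.tmul_sub,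
      Finset.sum_add_distrib, Finset.sum_sub_distrib, TensorProduct.ite_tmul,
      TensorProduct.tmul_ite, Finset.sum_ite_eq, Finset.sum_ite_eq', Finset.mem_univ, if_true,
      Finset.sum_ite_irrel, Finset.sum_const_zero]
    abel

/-- A weight function whose values, with the shifted weight, give the eigenvalues of the braided
Casimir element. -/
def casimirShift (n : ℕ) (c : ℂ) (nu : Fin n → ℂ) : ℂ :=
  2⁻¹ * ∑ i, nu i ^ 2 - ((n : ℂ) - 1) / 2 * ∑ i, nu i - c / 2

lemma casimirShift_comp_perm (c : ℂ) (nu : Fin n → ℂ) (σ : Equiv.Perm (Fin n)) :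
    casimirShift n c (nu ∘ σ) = casimirShift n c nu := by
  simp only [casimirShift, Function.comp_apply]
  rw [Equiv.sum_comp σ (fun i => nu i ^ 2), Equiv.sum_comp σ nu]

/-- The sum is the action of the second Gelfand invariant, which is central and scalar on the
generating vector `v₀`. -/
lemma IsIrrepOfHighestWeight.exists_casimir {lam : Fin n → ℂ} (hV : IsIrrepOfHighestWeight V lam) :
    ∃ c : ℂ, ∀ v : V, ∑ i : Fin n, ∑ j : Fin n, ⁅E i j, ⁅E j i, v⁆⁆ = c • v := by
  have := hV.irreducible
  obtain ⟨v₀, hv₀, hw⟩ := hV.highestWeight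
  have hact : ∀ v : V, uAct (gl n) V (gelfand n 2) v =
      ∑ i : Fin n, ∑ j : Fin n, ⁅E i j, ⁅E j i, v⁆⁆ := by
    intro v
    change uAct (gl n) V (∑ i, (genMatrix n ^ 2) i i) v = _
    simp only [pow_two, Matrix.mul_apply, genMatrix_apply, LinearMap.sum_apply, map_sum, map_mul,
      Module.End.mul_apply, uAct_ι]
  refine ⟨∑ i, gelfandCoef (shiftWt lam) 2 i, fun v => ?_⟩
  rw [← hact]
  refine eq_smul_of_mem_lieSpan (uAct_center_lie _) (S := {v₀}) (fun m hm => ?_) ?_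
  · rw [hm]
    exact uAct_gelfand hw 2
  · have h := eq_top_of_mem _ (LieSubmodule.subset_lieSpan (R := ℂ) (L := gl n)
      (Set.mem_singleton v₀)) hv₀
    rw [h]
    trivial

lemma sum_eq_sum_Iio_add_sum_Ioi {N : Type*} [AddCommGroup N] (f : Fin n → N) (i : Fin n) :
    ∑ j, f j = ∑ j ∈ Finset.Iio i, f j + f i + ∑ j ∈ Finset.Ioi i, f j := by
  have h : (Finset.univ : Finset (Fin n)) = Finset.Iic i ∪ Finset.Ioi i := by
    ext j
    simpa using le_or_gt j i
  have hd : Disjoint (Finset.Iic i) (Finset.Ioi i) :=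
    Finset.disjoint_left.mpr fun j hj hj' =>
      absurd (Finset.mem_Iic.mp hj) (not_le.mpr (Finset.mem_Ioi.mp hj'))
  rw [h, Finset.sum_union hd, ← Finset.Iio_insert, Finset.sum_insert (by simp), add_comm (f i)]

lemma sum_sum_lt_sub (w : Fin n → ℂ) :
    ∑ i, ∑ j ∈ Finset.Ioi i, (w i - w j) = ∑ i : Fin n, ((n : ℂ) - 1 - 2 * (i : ℂ)) * w i := by
  simp only [Finset.sum_sub_distrib, Finset.sum_const, Fin.card_Ioi, nsmul_eq_mul]
  have h : ∑ i, ∑ j ∈ Finset.Ioi i, w j = ∑ j : Fin n, (j : ℂ) * w j := by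
    rw [Finset.sum_comm' (t' := Finset.univ) (s' := fun j => Finset.Iio j) (by simp)]
    simp
  rw [h, ← Finset.sum_sub_distrib]
  refine Finset.sum_congr rfl fun i _ => ?_
  rw [Nat.sub_sub, Nat.cast_sub (by omega)]
  push_cast
  ring

end

/-! ### Triangularity of the braided Casimir element -/

namespace WeightBasis

variable {n : ℕ} {M V : Type*} [AddCommGroup M] [Module ℂ M] [LieRingModule (gl n) M]
  [LieModule ℂ (gl n) M] [AddCommGroup V] [Module ℂ V] [LieRingModule (gl n) V]
  [LieModule ℂ (gl n) V] (B : WeightBasis n V)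

/-- The submodule generated by the tensors of a vector with the basis vectors of depth less
than `d`. -/
def tensorFil (f : M) (d : ℤ) : LieSubmodule ℂ (gl n) (M ⊗[ℂ] V) :=
  LieSubmodule.lieSpan ℂ (gl n) {w | ∃ k, B.depth k < d ∧ f ⊗ₜ[ℂ] B.basis k = w}

lemma tensorFil_mono (f : M) {d e : ℤ} (h : d ≤ e) : B.tensorFil f d ≤ B.tensorFil f e :=
  LieSubmodule.lieSpan_mono fun _ ⟨k, hk, hw⟩ => ⟨k, hk.trans_le h, hw⟩

lemma tmul_lie_mem (f : M) {i j : Fin n} (hij : i < j) (k : Fin (Module.finrank ℂ V)) :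
    f ⊗ₜ[ℂ] ⁅E i j, B.basis k⁆ ∈ B.tensorFil f (B.depth k) := by
  rw [← B.basis.sum_repr ⁅E i j, B.basis k⁆, TensorProduct.tmul_sum]
  refine sum_mem fun k' _ => ?_
  rw [TensorProduct.tmul_smul]
  by_cases h : B.basis.repr ⁅E i j, B.basis k⁆ k' = 0
  · rw [h, zero_smul]; exact zero_mem _
  · exact (B.tensorFil f _).smul_mem _
      (LieSubmodule.subset_lieSpan ⟨k', B.depth_lt_of_repr_ne_zero hij h, rfl⟩)

/-- The eigenvalues of the braided Casimir element on the module generated by the tensors with a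
highest weight vector. -/
def eigenvalue (c : ℂ) (mu : Fin n → ℂ) (k : Fin (Module.finrank ℂ V)) : ℂ :=
  ∑ i, B.wt k i * shiftWt mu i + casimirShift n c (B.wt k)

/-- In the Casimir element the raise-then-lower part and the lower-then-raise part differ by the
diagonal commutators `E i i - E j j`. So twice the former equals the Casimir element minus diagonal
terms, a scalar on a weight vector. -/
lemma sum_lower_lie_raise {c : ℂ}
    (hc : ∀ v : V, ∑ i : Fin n, ∑ j : Fin n, ⁅E i j, ⁅E j i, v⁆⁆ = c • v)
    (k : Fin (Module.finrank ℂ V)) :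
    ∑ i : Fin n, ∑ j ∈ Finset.Iio i, ⁅E i j, ⁅E j i, B.basis k⁆⁆ =
      (2⁻¹ * (c - ∑ i, B.wt k i ^ 2 - ∑ i : Fin n, ((n : ℂ) - 1 - 2 * (i : ℂ)) * B.wt k i)) •
        B.basis k := by
  set L := ∑ i : Fin n, ∑ j ∈ Finset.Iio i, ⁅E i j, ⁅E j i, B.basis k⁆⁆ with hL
  have hup : ∑ i : Fin n, ∑ j ∈ Finset.Ioi i, ⁅E i j, ⁅E j i, B.basis k⁆⁆ =
      L + (∑ i, ∑ j ∈ Finset.Ioi i, (B.wt k i - B.wt k j)) • B.basis k := by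
    have h1 : L = ∑ i : Fin n, ∑ j ∈ Finset.Ioi i, ⁅E j i, ⁅E i j, B.basis k⁆⁆ := by
      rw [hL]
      exact Finset.sum_comm' (by simp)
    rw [h1, Finset.sum_smul, ← Finset.sum_add_distrib]
    refine Finset.sum_congr rfl fun i _ => ?_
    rw [Finset.sum_smul, ← Finset.sum_add_distrib]
    refine Finset.sum_congr rfl fun j _ => ?_
    rw [lie_lie_E_E, if_pos rfl, if_pos rfl, B.lie_basis, B.lie_basis, sub_smul]
  have h := hc (B.basis k)
  simp only [fun i => sum_eq_sum_Iio_add_sum_Ioi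
    (fun j => ⁅(E i j : gl n), ⁅(E j i : gl n), B.basis k⁆⁆) i, Finset.sum_add_distrib] at h
  rw [hup, ← hL, sum_sum_lt_sub] at h
  simp only [B.lie_basis, lie_smul, smul_smul, ← Finset.sum_smul] at h
  have h2 : (2 : ℂ) • L = (c - ∑ i, B.wt k i ^ 2 -
      ∑ i : Fin n, ((n : ℂ) - 1 - 2 * (i : ℂ)) * B.wt k i) • B.basis k := by
    rw [sub_smul, sub_smul, ← h]
    simp only [pow_two]
    module
  rw [mul_smul, ← h2, smul_smul]
  norm_num

/-- Raising operators kill `f` and diagonal ones act by weights. For `j < i`, the Leibniz rule moves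
`E i j` from `f` to the whole tensor, leaving an element of the smaller submodule and a correction
on `V` that sums to a scalar by `sum_lower_lie_raise`. -/
lemma omegaAct_sub_mem {c : ℂ}
    (hc : ∀ v : V, ∑ i : Fin n, ∑ j : Fin n, ⁅E i j, ⁅E j i, v⁆⁆ = c • v)
    {mu : Fin n → ℂ} {f : M} (hf : IsSingular mu f) (k : Fin (Module.finrank ℂ V)) :
    omegaAct n M V (f ⊗ₜ B.basis k) - B.eigenvalue c mu k • f ⊗ₜ[ℂ] B.basis k ∈
      B.tensorFil f (B.depth k) := by
  have key : omegaAct n M V (f ⊗ₜ B.basis k) - B.eigenvalue c mu k • f ⊗ₜ[ℂ] B.basis k =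
      ∑ i : Fin n, ∑ j ∈ Finset.Iio i, ⁅E i j, f ⊗ₜ[ℂ] ⁅E j i, B.basis k⁆⁆ := by
    have h1 : ∀ i : Fin n, ∑ j : Fin n, ⁅E i j, f⁆ ⊗ₜ[ℂ] ⁅E j i, B.basis k⁆ =
        ∑ j ∈ Finset.Iio i, ⁅E i j, f ⊗ₜ[ℂ] ⁅E j i, B.basis k⁆⁆ -
          f ⊗ₜ[ℂ] ∑ j ∈ Finset.Iio i, ⁅E i j, ⁅E j i, B.basis k⁆⁆ +
          (mu i * B.wt k i) • f ⊗ₜ[ℂ] B.basis k := by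
      intro i
      rw [sum_eq_sum_Iio_add_sum_Ioi _ i, hf.1, B.lie_basis, Finset.sum_eq_zero
        (s := Finset.Ioi i) fun j hj => by
          rw [hf.2 i j (Finset.mem_Ioi.mp hj), TensorProduct.zero_tmul], add_zero,
        TensorProduct.smul_tmul_smul, TensorProduct.tmul_sum, ← Finset.sum_sub_distrib]
      congr 1
      refine Finset.sum_congr rfl fun j _ => ?_
      rw [TensorProduct.LieModule.lie_tmul_right, add_sub_cancel_right]
    rw [omegaAct_tmul, Finset.sum_congr rfl fun i _ => h1 i, Finset.sum_add_distrib,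
      Finset.sum_sub_distrib, ← TensorProduct.tmul_sum, B.sum_lower_lie_raise hc,
      ← Finset.sum_smul, TensorProduct.tmul_smul]
    have h2 : B.eigenvalue c mu k = ∑ i, mu i * B.wt k i - 2⁻¹ * (c - ∑ i, B.wt k i ^ 2 -
        ∑ i : Fin n, ((n : ℂ) - 1 - 2 * (i : ℂ)) * B.wt k i) := by
      have h3 : ∑ i, B.wt k i * shiftWt mu i = ∑ i, mu i * B.wt k i +
          2⁻¹ * ∑ i : Fin n, ((n : ℂ) - 1 - 2 * (i : ℂ)) * B.wt k i +
          ((n : ℂ) - 1) / 2 * ∑ i, B.wt k i := by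
        rw [Finset.mul_sum, Finset.mul_sum, ← Finset.sum_add_distrib, ← Finset.sum_add_distrib]
        refine Finset.sum_congr rfl fun i _ => ?_
        rw [shiftWt]
        ring
      rw [eigenvalue, casimirShift, h3]
      ring
    rw [h2]
    module
  rw [key]
  exact sum_mem fun i _ => sum_mem fun j hj =>
    (B.tensorFil f _).lie_mem (B.tmul_lie_mem f (Finset.mem_Iio.mp hj) k)

lemma omegaAct_mem {c : ℂ}
    (hc : ∀ v : V, ∑ i : Fin n, ∑ j : Fin n, ⁅E i j, ⁅E j i, v⁆⁆ = c • v)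
    {mu : Fin n → ℂ} {f : M} (hf : IsSingular mu f) (d : ℤ) {w : M ⊗[ℂ] V}
    (hw : w ∈ B.tensorFil f d) : omegaAct n M V w ∈ B.tensorFil f d := by
  refine map_mem_of_mem_lieSpan omegaAct_lie ?_ hw
  rintro _ ⟨k, hk, rfl⟩
  have h1 := B.tensorFil_mono f hk.le (B.omegaAct_sub_mem hc hf k)
  have h2 : f ⊗ₜ[ℂ] B.basis k ∈ B.tensorFil f d := LieSubmodule.subset_lieSpan ⟨k, hk, rfl⟩
  simpa using add_mem h1 ((B.tensorFil f d).smul_mem (B.eigenvalue c mu k) h2)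

/-- The factors of depth exactly `d` push `tensorFil f (d + 1)` into `tensorFil f d`; below the
least depth `d₀` nothing is left. -/
lemma aeval_prod_eq_zero {c : ℂ}
    (hc : ∀ v : V, ∑ i : Fin n, ∑ j : Fin n, ⁅E i j, ⁅E j i, v⁆⁆ = c • v)
    {mu : Fin n → ℂ} {f : M} (hf : IsSingular mu f) {d₀ d : ℤ} (h₀ : ∀ k, d₀ ≤ B.depth k)
    (hd : d₀ ≤ d) {w : M ⊗[ℂ] V} (hw : w ∈ B.tensorFil f d) :
    Polynomial.aeval (omegaAct n M V) (∏ k with B.depth k < d,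
      (Polynomial.X - Polynomial.C (B.eigenvalue c mu k))) w = 0 := by
  induction d, hd using Int.leInduction generalizing w with
  | base =>
    have : B.tensorFil f d₀ = ⊥ := by
      rw [tensorFil, LieSubmodule.lieSpan_eq_bot_iff]
      rintro _ ⟨k, hk, rfl⟩
      exact absurd hk (not_lt.mpr (h₀ k))
    rw [this, LieSubmodule.mem_bot] at hw
    rw [hw, map_zero]
  | succ d _ ih =>
    have hsplit : (Finset.univ.filter fun k => B.depth k < d + 1) =
        (Finset.univ.filter fun k => B.depth k < d).disjUnion
          (Finset.univ.filter fun k => B.depth k = d)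
          (Finset.disjoint_filter.mpr fun k _ h h' => h.ne h') := by
      ext k
      simp only [Finset.mem_filter, Finset.mem_univ, true_and, Finset.mem_disjUnion]
      omega
    rw [hsplit, Finset.prod_disjUnion, map_mul, Module.End.mul_apply]
    refine ih ?_
    refine map_mem_of_mem_lieSpan (fun X m => ?_) ?_ hw
    · exact aeval_lie omegaAct_lie _ X m
    · rintro _ ⟨k, hk, rfl⟩
      rcases (Int.lt_add_one_iff.mp hk).lt_or_eq with h | h
      · exact aeval_mem (N := (B.tensorFil f d).toSubmodule)
          (fun m hm => B.omegaAct_mem hc hf d hm) _ (LieSubmodule.subset_lieSpan ⟨k, h, rfl⟩)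
      -- The factor belonging to `k` is applied first and lands in the smaller submodule, which the
      -- others preserve.
      · rw [← Finset.prod_erase_mul _ _ (Finset.mem_filter.mpr ⟨Finset.mem_univ k, h⟩), map_mul,
          Module.End.mul_apply]
        refine aeval_mem (N := (B.tensorFil f d).toSubmodule)
          (fun m hm => B.omegaAct_mem hc hf d hm) _ ?_
        have h1 := B.omegaAct_sub_mem hc hf k
        rw [h] at h1
        simpa using h1

end WeightBasis

end BraidedCasimir

namespace BraidedCasimir

/-! ### The characteristic identity for `gl n` -/

section

variable (L : Type*) [LieRing L] [LieAlgebra ℂ L]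

instance nontrivial_U : Nontrivial (U L) :=
  (UniversalEnvelopingAlgebra.lift ℂ (0 : L →ₗ⁅ℂ⁆ ℂ)).toRingHom.domain_nontrivial

end

section

variable (n : ℕ) (V : Type*) [AddCommGroup V] [Module ℂ V]

/-- The action of `U(gl n) ⊗ End V` on the tensor product of the polarization module with `V`. -/
def tensorAct : U (gl n) ⊗[ℂ] Module.End ℂ V →ₐ[ℂ] Module.End ℂ (MatPoly n ⊗[ℂ] V) :=
  (Module.endTensorEndAlgHom (R := ℂ) (S := ℂ) (A := ℂ) (M := MatPoly n) (N := V)).comp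
    (Algebra.TensorProduct.map (uAct (gl n) (MatPoly n)) (AlgHom.id ℂ (Module.End ℂ V)))

lemma tensorAct_tmul (y : U (gl n)) (g : Module.End ℂ V) :
    tensorAct n V (y ⊗ₜ g) = TensorProduct.map (uAct (gl n) (MatPoly n) y) g := rfl

lemma tensorAct_mul (x y : U (gl n) ⊗[ℂ] Module.End ℂ V) :
    tensorAct n V (x * y) = tensorAct n V x * tensorAct n V y :=
  (tensorAct n V).map_mul' x y

lemma tensorAct_pow (x : U (gl n) ⊗[ℂ] Module.End ℂ V) (j : ℕ) :
    tensorAct n V (x ^ j) = tensorAct n V x ^ j := by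
  induction j with
  | zero => exact (tensorAct n V).map_one'
  | succ j ih => rw [pow_succ, tensorAct_mul, ih, ← pow_succ]

lemma tensorAct_Omega [LieRingModule (gl n) V] [LieModule ℂ (gl n) V] : tensorAct n V (Omega n V) = omegaAct n (MatPoly n) V := by
  rw [Omega, omegaAct, map_sum]
  refine Finset.sum_congr rfl fun i _ => ?_
  rw [map_sum]
  refine Finset.sum_congr rfl fun j _ => ?_
  rw [tensorAct_tmul]
  congr 1
  exact LinearMap.ext fun m => uAct_ι (L := gl n) (M := MatPoly n) _ m

/-- Expanding over matrix units of `End V`, the `b k` component of the action on `m ⊗ b k'` isolates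
a single coefficient, and `uAct_matPoly_injective` applies to it. -/
lemma tensorAct_injective [FiniteDimensional ℂ V] : Function.Injective (tensorAct n V) := by
  classical
  rw [injective_iff_map_eq_zero]
  intro y hy
  let b := Module.finBasis ℂ V
  obtain ⟨a, rfl⟩ := TensorProduct.eq_repr_basis_right b.end y
  have ha : a = 0 := by
    ext ⟨k, k'⟩
    apply uAct_matPoly_injective n
    rw [Finsupp.zero_apply, map_zero]
    refine LinearMap.ext fun m => ?_
    have h := LinearMap.congr_fun hy (m ⊗ₜ b k')
    rw [Finsupp.sum, map_sum, LinearMap.sum_apply] at h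
    simp only [tensorAct_tmul, TensorProduct.map_tmul, Module.Basis.end_apply_apply] at h
    have h2 := congrArg (fun w => TensorProduct.rid ℂ _ ((b.coord k).lTensor (MatPoly n) w)) h
    simp only [map_sum, LinearMap.lTensor_tmul, TensorProduct.rid_tmul, LinearMap.zero_apply,
      map_zero] at h2
    rw [LinearMap.zero_apply, ← h2, Finset.sum_eq_single (k, k')]
    · simp
    · rintro ⟨i, j⟩ _ hij
      by_cases hj : j = k'
      · have : i ≠ k := fun h => hij (by rw [h, hj])
        simp [hj, Finsupp.single_eq_of_ne' this]
      · simp [hj]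
    · intro h0
      rw [Finsupp.notMem_support_iff.mp h0]
      simp
  simp [ha]

end

variable {n : ℕ} {V : Type*} [AddCommGroup V] [Module ℂ V] [LieRingModule (gl n) V]
  [LieModule ℂ (gl n) V]

/-- The `x` with `x ⊗ V` inside the submodule generated by `f ⊗ V` form a submodule, since `Xx ⊗ v =
X(x ⊗ v) - x ⊗ Xv`; the highest weight vectors `f` generate everything. -/
lemma eq_zero_of_forall_isSingular (T : Module.End ℂ (MatPoly n ⊗[ℂ] V))
    (hT : ∀ (mu : Fin n → ℂ) (f : MatPoly n), IsSingular mu f → ∀ w ∈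
      LieSubmodule.lieSpan ℂ (gl n) {w | ∃ v : V, f ⊗ₜ[ℂ] v = w}, T w = 0) : T = 0 := by
  have key : ∀ (mu : Fin n → ℂ) (f : MatPoly n), IsSingular mu f →
      ∀ x ∈ LieSubmodule.lieSpan ℂ (gl n) {f}, ∀ v : V, x ⊗ₜ[ℂ] v ∈
        LieSubmodule.lieSpan ℂ (gl n) {w | ∃ v : V, f ⊗ₜ[ℂ] v = w} := by
    intro mu f _ x hx
    set G := LieSubmodule.lieSpan ℂ (gl n) {w | ∃ v : V, f ⊗ₜ[ℂ] v = w}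
    let N : LieSubmodule ℂ (gl n) (MatPoly n) :=
      { carrier := {x | ∀ v : V, x ⊗ₜ[ℂ] v ∈ G}
        add_mem' := fun hx hy v => by rw [TensorProduct.add_tmul]; exact add_mem (hx v) (hy v)
        zero_mem' := fun v => by rw [TensorProduct.zero_tmul]; exact zero_mem _
        smul_mem' := fun c x hx v => by
          rw [← TensorProduct.smul_tmul']; exact G.smul_mem c (hx v)
        lie_mem := fun {X x} hx v => by
          have h := sub_mem (G.lie_mem (x := X) (hx v)) (hx ⁅X, v⁆)
          rwa [TensorProduct.LieModule.lie_tmul_right, add_sub_cancel_right] at h }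
    have hN : LieSubmodule.lieSpan ℂ (gl n) {f} ≤ N := by
      rw [LieSubmodule.lieSpan_le]
      rintro _ rfl v
      exact LieSubmodule.subset_lieSpan ⟨v, rfl⟩
    exact hN hx
  have hall : ∀ x : MatPoly n, ∀ v : V, T (x ⊗ₜ v) = 0 := by
    have hle : LieSubmodule.lieSpan ℂ (gl n) {g : MatPoly n | ∃ mu : Fin n → ℂ, IsSingular mu g} ≤
        ⨆ f : {g : MatPoly n // ∃ mu : Fin n → ℂ, IsSingular mu g},
          LieSubmodule.lieSpan ℂ (gl n) {(f : MatPoly n)} :=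
      LieSubmodule.lieSpan_le.mpr fun f hf =>
        le_iSup (fun f : {g : MatPoly n // ∃ mu : Fin n → ℂ, IsSingular mu g} =>
          LieSubmodule.lieSpan ℂ (gl n) {(f : MatPoly n)}) ⟨f, hf⟩ (LieSubmodule.subset_lieSpan rfl)
    intro x v
    have hx := hle (mem_lieSpan_isSingular x)
    rw [← LieSubmodule.mem_toSubmodule, LieSubmodule.iSup_toSubmodule] at hx
    have hker : (⨆ f : {g : MatPoly n // ∃ mu : Fin n → ℂ, IsSingular mu g},
        (LieSubmodule.lieSpan ℂ (gl n) {(f : MatPoly n)}).toSubmodule) ≤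
        LinearMap.ker (T ∘ₗ (TensorProduct.mk ℂ (MatPoly n) V).flip v) :=
      iSup_le fun ⟨f, mu, hf⟩ y hy => hT mu f hf _ (key mu f hf y hy v)
    exact hker hx
  exact TensorProduct.ext' hall

/-- The characteristic identity for `gl n`, with a monic polynomial. -/
theorem exists_charIdentity {lam : Fin n → ℂ} (hV : IsIrrepOfHighestWeight V lam) :
    ∃ P : Polynomial (Z (gl n)), P.Monic ∧ P.natDegree = Module.finrank ℂ V ∧
      evalAt (Omega n V) P = 0 := by
  have := hV.finiteDimensional
  obtain ⟨B⟩ := hV.nonempty_weightBasis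
  obtain ⟨c, hc⟩ := hV.exists_casimir
  set N := Module.finrank ℂ V with hN
  set Q := B.charPoly (casimirShift n c) with hQ
  choose z hz using fun j => exists_central_of_isSymmetric
    (B.coeff_charPoly_isSymmetric (casimirShift_comp_perm (n := n) c) j)
  have hdeg : (∑ j ∈ Finset.range N, Polynomial.monomial j (z j)).degree < (N : WithBot ℕ) := by
    rw [← Polynomial.mem_degreeLT]
    refine sum_mem fun j hj => Polynomial.mem_degreeLT.mpr ?_
    exact (Polynomial.degree_monomial_le _ _).trans_lt
      (WithBot.coe_lt_coe.mpr (Finset.mem_range.mp hj))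
  -- The leading coefficient is set to 1 by hand, and only the `z j` with `j < N` are used.
  refine ⟨Polynomial.X ^ N + ∑ j ∈ Finset.range N, Polynomial.monomial j (z j),
    Polynomial.monic_X_pow_add hdeg, ?_, ?_⟩
  · rw [add_comm]
    exact Polynomial.natDegree_eq_of_degree_eq_some
      ((Polynomial.degree_add_eq_right_of_degree_lt
        (by rwa [Polynomial.degree_X_pow])).trans (Polynomial.degree_X_pow N))
  apply tensorAct_injective n V
  rw [map_zero]
  refine eq_zero_of_forall_isSingular _ fun mu f hf w hw => ?_
  obtain ⟨d₀, hd₀⟩ := (Set.finite_range B.depth).bddBelow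
  obtain ⟨d₁, hd₁⟩ := (Set.finite_range B.depth).bddAbove
  have hlt : ∀ k, B.depth k < max d₀ (d₁ + 1) := fun k =>
    lt_max_of_lt_right (Int.lt_add_one_iff.mpr (hd₁ ⟨k, rfl⟩))
  have hfil : ∀ w ∈ LieSubmodule.lieSpan ℂ (gl n) {w | ∃ v : V, f ⊗ₜ[ℂ] v = w},
      w ∈ B.tensorFil f (max d₀ (d₁ + 1)) := by
    have hle : LieSubmodule.lieSpan ℂ (gl n) {w | ∃ v : V, f ⊗ₜ[ℂ] v = w} ≤
        B.tensorFil f (max d₀ (d₁ + 1)) := by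
      rw [LieSubmodule.lieSpan_le]
      rintro _ ⟨v, rfl⟩
      rw [← B.basis.sum_repr v, TensorProduct.tmul_sum]
      refine sum_mem fun k _ => ?_
      rw [TensorProduct.tmul_smul]
      exact (B.tensorFil f _).smul_mem _ (LieSubmodule.subset_lieSpan ⟨k, hlt k, rfl⟩)
    exact fun w hw => hle hw
  have hprod := B.aeval_prod_eq_zero hc hf (fun k => hd₀ ⟨k, rfl⟩) (le_max_left d₀ (d₁ + 1))
    (hfil w hw)
  have hQmap : (∏ k with B.depth k < max d₀ (d₁ + 1), (Polynomial.X - Polynomial.C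
      (B.eigenvalue c mu k))) = Q.map (MvPolynomial.eval (shiftWt mu)) := by
    rw [Finset.filter_true_of_mem fun k _ => hlt k, hQ, WeightBasis.charPoly, Polynomial.map_prod]
    refine Finset.prod_congr rfl fun k _ => ?_
    rw [Polynomial.map_sub, Polynomial.map_X, Polynomial.map_C]
    simp only [WeightBasis.eigenvalue, map_add, map_sum, map_mul, MvPolynomial.eval_C,
      MvPolynomial.eval_X]
  have hQmonic : Q.Monic := Polynomial.monic_prod_X_sub_C _ _
  have hQdeg : Q.natDegree = N := by
    rw [hQ, WeightBasis.charPoly, Polynomial.natDegree_prod_of_monic _ _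
      fun k _ => Polynomial.monic_X_sub_C _]
    simp only [Polynomial.natDegree_X_sub_C, Finset.sum_const, Finset.card_univ, Fintype.card_fin,
      smul_eq_mul, mul_one, hN]
  have hQsum : Q = Polynomial.X ^ N + ∑ j ∈ Finset.range N,
      Polynomial.C (Q.coeff j) * Polynomial.X ^ j := by
    conv_lhs => rw [hQmonic.as_sum, hQdeg]
  have hpow : ∀ j, (omegaAct n (MatPoly n) V ^ j) w ∈ B.tensorFil f (max d₀ (d₁ + 1)) := fun j => by
    have h := aeval_mem (N := (B.tensorFil f (max d₀ (d₁ + 1))).toSubmodule)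
      (fun m hm => B.omegaAct_mem hc hf _ hm) (Polynomial.X ^ j) (hfil w hw)
    rwa [map_pow, Polynomial.aeval_X] at h
  -- The element `z j ⊗ 1` commutes with the diagonal action, so its scalar on the generators `f ⊗ b
  -- k` extends to the submodule.
  have hcentral : ∀ j, ∀ w ∈ B.tensorFil f (max d₀ (d₁ + 1)),
      tensorAct n V ((z j : U (gl n)) ⊗ₜ 1) w =
        MvPolynomial.eval (shiftWt mu) (Q.coeff j) • w := by
    intro j w hw
    refine eq_smul_of_mem_lieSpan (fun X w => ?_) ?_ hw
    · rw [tensorAct_tmul]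
      induction w using TensorProduct.induction_on with
      | zero => simp
      | add w w' h h' => simp only [lie_add, map_add, h, h']
      | tmul m v =>
        simp only [TensorProduct.LieModule.lie_tmul_right, map_add, TensorProduct.map_tmul,
          uAct_center_lie, Module.End.one_apply]
    · rintro _ ⟨k, _, rfl⟩
      rw [tensorAct_tmul, TensorProduct.map_tmul, hz j mu f hf, TensorProduct.smul_tmul']
      rfl
  rw [evalAt, Polynomial.eval₂_add, Polynomial.eval₂_X_pow, Polynomial.eval₂_finsetSum, map_add,
    map_sum, tensorAct_pow, tensorAct_Omega]
  rw [hQmap, hQsum] at hprod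
  rw [← hprod]
  simp only [Polynomial.map_add, Polynomial.map_pow, Polynomial.map_X, Polynomial.map_sum,
    Polynomial.map_mul, Polynomial.map_C, map_add, map_pow, map_sum, map_mul, Polynomial.aeval_X,
    Polynomial.aeval_C, LinearMap.add_apply, LinearMap.sum_apply, Module.End.mul_apply]
  congr 1
  refine Finset.sum_congr rfl fun j _ => ?_
  rw [Polynomial.eval₂_monomial, tensorAct_mul, tensorAct_pow, tensorAct_Omega, Module.End.mul_apply]
  exact hcentral j _ (hpow j)

end BraidedCasimir

namespace BraidedCasimir

/-! ### Transfer to `sl n` -/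

/-- Summation by parts, with both boundary terms kept. -/
lemma sum_sub_tmul_add {A B : Type*} [AddCommGroup A] [Module ℂ A] [AddCommGroup B] [Module ℂ B]
    (T : ℕ → B) {m : ℕ} (a : Fin (m + 1) → A) :
    ∑ i : Fin m, (a i.castSucc - a i.succ) ⊗ₜ[ℂ] T (i + 1) + a (Fin.last m) ⊗ₜ[ℂ] T (m + 1) =
      ∑ i : Fin (m + 1), a i ⊗ₜ[ℂ] (T (i + 1) - T i) + a 0 ⊗ₜ[ℂ] T 0 := by
  induction m with
  | zero => simp [TensorProduct.tmul_sub]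
  | succ m ih =>
    have h := ih fun i => a i.castSucc
    rw [Fin.sum_univ_castSucc, Fin.sum_univ_castSucc (n := m + 1)]
    simp only [Fin.val_castSucc, Fin.val_last, Fin.succ_last, Fin.castSucc_zero,
      ← Fin.castSucc_succ, TensorProduct.tmul_sub, TensorProduct.sub_tmul] at h ⊢
    rw [← sub_eq_zero] at h ⊢
    rw [← h]
    abel

lemma sum_E (n : ℕ) : ∑ i : Fin n, (E i i : gl n) = 1 := by
  rw [gl_eq_sum (1 : gl n)]
  refine Finset.sum_congr rfl fun i _ => ?_
  rw [Finset.sum_eq_single i]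
  · simp
  · intro j _ hj
    simp [Matrix.one_apply_ne' hj]
  · simp

/-- The split Casimir tensor of `gl n`, in terms of the dual bases of `sl n`. -/
lemma sum_E_tmul_E (n : ℕ) (hn : 1 ≤ n) :
    ∑ i : Fin n, ∑ j : Fin n, (E i j : gl n) ⊗ₜ[ℂ] (E j i : gl n) =
      (∑ i : Fin n, ∑ j : Fin n, if h : i ≠ j then
        (slE i j h : gl n) ⊗ₜ[ℂ] (slE j i h.symm : gl n) else 0) +
      ∑ i : Fin (n - 1), (slH i : gl n) ⊗ₜ[ℂ] (slHdual i : gl n) +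
      ((n : ℂ)⁻¹) • (1 : gl n) ⊗ₜ[ℂ] (1 : gl n) := by
  obtain ⟨m, rfl⟩ : ∃ m, n = m + 1 := ⟨n - 1, by omega⟩
  have hm : ((m + 1 : ℕ) : ℂ) ≠ 0 := by exact_mod_cast Nat.succ_ne_zero m
  have hone := (sum_E (m + 1)).symm
  -- These partial sums interpolate the duals `slHdual`, with index shifted by one. They vanish at
  -- both ends and have increments `E i i - 1/n`, so summation by parts yields the diagonal tensor
  -- minus `(1/n) 1 ⊗ 1`.
  let T : ℕ → gl (m + 1) := fun k =>
    (∑ j : Fin (m + 1), if (j : ℕ) < k then E j j else 0) - ((k : ℂ) / ((m + 1 : ℕ) : ℂ)) • 1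
  have hT0 : T 0 = 0 := by simp [T]
  have hTn : T (m + 1) = 0 := by
    simp only [T, Fin.is_lt, if_true, ← hone, div_self hm, one_smul, sub_self]
  have hTs : ∀ i : Fin (m + 1), T (i + 1) - T i = E i i - (((m + 1 : ℕ) : ℂ)⁻¹) • 1 := by
    intro i
    have h : (∑ j : Fin (m + 1), if (j : ℕ) < (i : ℕ) + 1 then (E j j : gl (m + 1)) else 0) =
        (∑ j : Fin (m + 1), if (j : ℕ) < (i : ℕ) then E j j else 0) + E i i := by
      have h1 : (E i i : gl (m + 1)) = ∑ j : Fin (m + 1), if j = i then E j j else 0 := by simp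
      rw [h1, ← Finset.sum_add_distrib]
      refine Finset.sum_congr rfl fun j _ => ?_
      rcases lt_trichotomy j i with h | h | h
      · simp [h.ne, Fin.lt_def.mp h, (Fin.lt_def.mp h).le]
      · simp [h]
      · simp [h.ne', h.not_ge, h.not_gt]
    simp only [T, h, Nat.cast_add, Nat.cast_one, add_div, add_smul, one_div]
    abel
  have habel := sum_sub_tmul_add T (fun i : Fin (m + 1) => (E i i : gl (m + 1)))
  rw [hT0, hTn, TensorProduct.tmul_zero, TensorProduct.tmul_zero, add_zero, add_zero] at habel
  have hH : ∑ i : Fin (m + 1 - 1), (slH i : gl (m + 1)) ⊗ₜ[ℂ] (slHdual i : gl (m + 1)) =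
      ∑ i : Fin (m + 1), (E i i : gl (m + 1)) ⊗ₜ[ℂ] (E i i : gl (m + 1)) -
        (((m + 1 : ℕ) : ℂ)⁻¹) • (1 : gl (m + 1)) ⊗ₜ[ℂ] (1 : gl (m + 1)) := by
    have h2 : ∑ i : Fin (m + 1 - 1), (slH i : gl (m + 1)) ⊗ₜ[ℂ] (slHdual i : gl (m + 1)) =
        ∑ i : Fin m, ((E i.castSucc i.castSucc : gl (m + 1)) - E i.succ i.succ) ⊗ₜ[ℂ]
          T (i + 1) := by
      refine Finset.sum_congr rfl fun i _ => ?_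
      congr 1
      simp only [T, slHdual, Nat.lt_succ_iff, Nat.cast_add, Nat.cast_one]
    rw [h2, habel]
    simp only [hTs, TensorProduct.tmul_sub, Finset.sum_sub_distrib, TensorProduct.tmul_smul,
      ← Finset.smul_sum, ← TensorProduct.sum_tmul, ← hone]
  rw [hH, add_assoc, sub_add_cancel, ← Finset.sum_add_distrib]
  refine Finset.sum_congr rfl fun i _ => ?_
  rw [← Finset.add_sum_erase _ _ (Finset.mem_univ i)]
  refine (add_comm _ _).trans ?_
  congr 1
  rw [← Finset.sum_erase Finset.univ (a := i) (by simp)]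
  refine Finset.sum_congr rfl fun j hj => ?_
  rw [dif_pos (Finset.ne_of_mem_erase hj).symm]
  rfl

/-! ### Maps between the two enveloping algebras and their centers -/

/-- The projection of `gl n` onto `sl n` along the scalar matrices. -/
def toSl (n : ℕ) (hn : 1 ≤ n) : gl n →ₗ⁅ℂ⁆ sl n where
  toFun X := ⟨X - (Matrix.trace X / n) • 1, LinearMap.mem_ker.mpr (by
    have : (n : ℂ) ≠ 0 := by exact_mod_cast (by omega : n ≠ 0)
    simp [Matrix.trace_sub, Matrix.trace_smul, this])⟩
  map_add' X Y := Subtype.ext (by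
    change X + Y - (Matrix.trace (X + Y) / n) • 1 =
      X - (Matrix.trace X / n) • 1 + (Y - (Matrix.trace Y / n) • 1)
    rw [Matrix.trace_add, add_div, add_smul, add_sub_add_comm])
  map_smul' c X := Subtype.ext (by
    simp [Matrix.trace_smul, smul_sub, mul_div_assoc, mul_smul])
  map_lie' := fun {X Y} => Subtype.ext (by
    simp only [LieSubalgebra.coe_bracket, Ring.lie_def, sub_mul, mul_sub, Matrix.trace_sub,
      Matrix.trace_mul_comm X Y, sub_self, zero_div, zero_smul, sub_zero, smul_mul_assoc,
      mul_smul_comm, one_mul, mul_one]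
    rw [smul_sub, smul_sub, smul_comm (Matrix.trace Y / (n : ℂ)) (Matrix.trace X / (n : ℂ)) (1 : gl n)]
    abel)

variable (n : ℕ) (hn : 1 ≤ n)

lemma coe_toSl (X : gl n) : (toSl n hn X : gl n) = X - (Matrix.trace X / n) • 1 := rfl

lemma toSl_coe (X : sl n) : toSl n hn X = X := by
  have h : Matrix.trace (X : gl n) = 0 := X.2
  exact Subtype.ext (by rw [coe_toSl, h, zero_div, zero_smul, sub_zero])

lemma toSl_one : toSl n hn 1 = 0 := by
  have : (n : ℂ) ≠ 0 := by exact_mod_cast (by omega : n ≠ 0)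
  exact Subtype.ext (by rw [coe_toSl, Matrix.trace_one, Fintype.card_fin, div_self this,
    one_smul, sub_self]; rfl)

/-- The homomorphism of enveloping algebras induced by `toSl`. -/
def UglToUsl : U (gl n) →ₐ[ℂ] U (sl n) :=
  UniversalEnvelopingAlgebra.lift ℂ ((UniversalEnvelopingAlgebra.ι ℂ).comp (toSl n hn))

lemma UglToUsl_ι (X : gl n) : UglToUsl n hn (UniversalEnvelopingAlgebra.ι ℂ X) =
    UniversalEnvelopingAlgebra.ι ℂ (toSl n hn X) :=
  UniversalEnvelopingAlgebra.lift_ι_apply' ℂ _ X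

lemma UslToUgl_ι (X : sl n) : UslToUgl n (UniversalEnvelopingAlgebra.ι ℂ X) =
    UniversalEnvelopingAlgebra.ι ℂ (X : gl n) :=
  UniversalEnvelopingAlgebra.lift_ι_apply' ℂ _ X

lemma UglToUsl_UslToUgl (y : U (sl n)) : UglToUsl n hn (UslToUgl n y) = y := by
  have h : (UglToUsl n hn).comp (UslToUgl n) = AlgHom.id ℂ (U (sl n)) := by
    refine UniversalEnvelopingAlgebra.hom_ext ℂ (LieHom.ext fun X => ?_)
    change UglToUsl n hn (UslToUgl n (UniversalEnvelopingAlgebra.ι ℂ X)) =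
      UniversalEnvelopingAlgebra.ι ℂ X
    rw [UslToUgl_ι, UglToUsl_ι, toSl_coe]
  exact DFunLike.congr_fun h y

/-- `UglToUsl` on the centers. -/
def ZglToZsl : Z (gl n) →ₐ[ℂ] Z (sl n) :=
  ((UglToUsl n hn).comp (Z (gl n)).val).codRestrict (Z (sl n)) fun z => by
    rw [Subalgebra.mem_center_iff]
    intro y
    -- The projection is surjective, with section `UslToUgl`, and so preserves centrality.
    have h := congrArg (UglToUsl n hn) (Subalgebra.mem_center_iff.mp z.2 (UslToUgl n y))
    rwa [map_mul, map_mul, UglToUsl_UslToUgl] at h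

lemma ι_one_mem_center : UniversalEnvelopingAlgebra.ι ℂ (1 : gl n) ∈ Z (gl n) :=
  mem_center_of_commute_ι fun X => by
    rw [commute_iff_lie_eq, ← LieHom.map_lie, Ring.lie_def, mul_one, one_mul, sub_self, map_zero]

/-- Only scalar matrices are missing from `sl n`, and they are central already. -/
lemma UslToUgl_mem_center (hn : 1 ≤ n) (z : Z (sl n)) : UslToUgl n z ∈ Z (gl n) :=
  mem_center_of_commute_ι fun X => by
    have h : X = (toSl n hn X : gl n) + (Matrix.trace X / n) • 1 := by
      rw [coe_toSl, sub_add_cancel]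
    rw [h, map_add, map_smul, ← UslToUgl_ι]
    refine Commute.add_left ?_ (Commute.smul_left ?_ _)
    · exact Commute.map (f := UslToUgl n) (Subalgebra.mem_center_iff.mp z.2 _)
    · exact (Subalgebra.mem_center_iff.mp (ι_one_mem_center n) _).symm

/-- `UslToUgl` on the centers. -/
def ZslToZgl : Z (sl n) →ₐ[ℂ] Z (gl n) :=
  ((UslToUgl n).comp (Z (sl n)).val).codRestrict (Z (gl n)) (UslToUgl_mem_center n hn)

lemma Delta_eq : Delta n = UniversalEnvelopingAlgebra.ι ℂ (1 : gl n) := by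
  rw [Delta, ← map_sum, sum_E]

section

variable (V : Type*) [AddCommGroup V] [Module ℂ V] [LieRingModule (gl n) V]
  [LieModule ℂ (gl n) V]

/-- The map `x ⊗ y ↦ φ x ⊗ π y` on `gl n ⊗ gl n`. -/
def tensorRep {A : Type*} [AddCommGroup A] [Module ℂ A] (φ : gl n →ₗ[ℂ] A) :
    gl n ⊗[ℂ] gl n →ₗ[ℂ] A ⊗[ℂ] Module.End ℂ V :=
  TensorProduct.map φ (LieModule.toEnd ℂ (gl n) V : gl n →ₗ[ℂ] Module.End ℂ V)

lemma tensorRep_tmul {A : Type*} [AddCommGroup A] [Module ℂ A] (φ : gl n →ₗ[ℂ] A) (X Y : gl n) :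
    tensorRep n V φ (X ⊗ₜ Y) = φ X ⊗ₜ LieModule.toEnd ℂ (gl n) V Y := rfl

lemma tensorRep_sum_E {A : Type*} [AddCommGroup A] [Module ℂ A] (φ : gl n →ₗ[ℂ] A) (hn : 1 ≤ n) :
    ∑ i : Fin n, ∑ j : Fin n, φ (E i j) ⊗ₜ[ℂ] LieModule.toEnd ℂ (gl n) V (E j i) =
      (∑ i : Fin n, ∑ j : Fin n, if h : i ≠ j then φ (slE i j h) ⊗ₜ[ℂ]
        LieModule.toEnd ℂ (sl n) V (slE j i h.symm) else 0) +
      ∑ i : Fin (n - 1), φ (slH i) ⊗ₜ[ℂ] LieModule.toEnd ℂ (sl n) V (slHdual i) +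
      ((n : ℂ)⁻¹) • φ 1 ⊗ₜ[ℂ] LieModule.toEnd ℂ (gl n) V 1 := by
  have h := congrArg (tensorRep n V φ) (sum_E_tmul_E n hn)
  simp only [map_add, map_sum, map_smul, tensorRep_tmul] at h
  rw [h]
  congr 2
  refine Finset.sum_congr rfl fun i _ => Finset.sum_congr rfl fun j _ => ?_
  split_ifs
  · rfl
  · exact map_zero _

end

variable {n} {V : Type*} [AddCommGroup V] [Module ℂ V] [LieRingModule (gl n) V]
  [LieModule ℂ (gl n) V]

lemma IsIrrepOfHighestWeight.toEnd_one {lam : Fin n → ℂ} (hV : IsIrrepOfHighestWeight V lam) :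
    LieModule.toEnd ℂ (gl n) V 1 = (∑ i, lam i) • (1 : Module.End ℂ V) := by
  have := hV.irreducible
  obtain ⟨v₀, hv₀, hw, -⟩ := hV.highestWeight
  refine LinearMap.ext fun v => ?_
  refine eq_smul_of_mem_lieSpan (L := gl n) (S := {v₀}) (fun X m => ?_) (fun m hm => ?_) ?_
  · have h : ⁅(1 : gl n), X⁆ = 0 := by rw [Ring.lie_def, one_mul, mul_one, sub_self]
    rw [LieModule.toEnd_apply_apply, LieModule.toEnd_apply_apply, leibniz_lie, h, zero_lie,
      zero_add]
  · rw [Set.mem_singleton_iff.mp hm, LieModule.toEnd_apply_apply, ← sum_E, sum_lie, Finset.sum_smul]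
    exact Finset.sum_congr rfl fun i _ => hw i
  · rw [eq_top_of_mem _ (LieSubmodule.subset_lieSpan (R := ℂ) (L := gl n)
      (Set.mem_singleton v₀)) hv₀]
    trivial

lemma map_UglToUsl_Omega (hn : 1 ≤ n) :
    Algebra.TensorProduct.map (UglToUsl n hn) (AlgHom.id ℂ (Module.End ℂ V)) (Omega n V) =
      omegaSl n V := by
  have h := tensorRep_sum_E n V ((UniversalEnvelopingAlgebra.ι ℂ : sl n →ₗ⁅ℂ⁆ U (sl n)).toLinearMap
    ∘ₗ (toSl n hn : gl n →ₗ[ℂ] sl n)) hn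
  simp only [LinearMap.comp_apply, LieHom.coe_toLinearMap, toSl_coe, toSl_one, map_zero,
    TensorProduct.zero_tmul, smul_zero, add_zero] at h
  rw [omegaSl, ← h, Omega, map_sum]
  refine Finset.sum_congr rfl fun i _ => ?_
  rw [map_sum]
  refine Finset.sum_congr rfl fun j _ => ?_
  rw [Algebra.TensorProduct.map_tmul, UglToUsl_ι]
  rfl

/-- The correction `(1/n) 1 ⊗ 1` becomes `(d/n) Δ ⊗ 1`, because the identity matrix acts on `V` by
`d`. -/
lemma map_UslToUgl_omegaSl {lam : Fin n → ℂ} (hV : IsIrrepOfHighestWeight V lam) (hn : 1 ≤ n) :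
    Algebra.TensorProduct.map (UslToUgl n) (AlgHom.id ℂ (Module.End ℂ V)) (omegaSl n V) =
      Omega n V - (((∑ i, lam i) / (n : ℂ)) • Delta n) ⊗ₜ 1 := by
  have h := tensorRep_sum_E n V
    (UniversalEnvelopingAlgebra.ι ℂ : gl n →ₗ⁅ℂ⁆ U (gl n)).toLinearMap hn
  simp only [LieHom.coe_toLinearMap] at h
  rw [Omega, h, hV.toEnd_one, ← Delta_eq, TensorProduct.tmul_smul, smul_smul, div_eq_inv_mul,
    TensorProduct.smul_tmul', add_sub_cancel_right, omegaSl, map_add, map_sum, map_sum]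
  congr 1
  · refine Finset.sum_congr rfl fun i _ => ?_
    rw [map_sum]
    refine Finset.sum_congr rfl fun j _ => ?_
    split_ifs
    · rw [Algebra.TensorProduct.map_tmul, UslToUgl_ι]
      rfl
    · exact map_zero _
  · refine Finset.sum_congr rfl fun i _ => ?_
    rw [Algebra.TensorProduct.map_tmul, UslToUgl_ι]
    rfl

/-! ### Evaluation of polynomials with central coefficients -/

/-- With central image, `f` makes the noncommutative ring `A` an `R`-algebra. -/
lemma eval₂_comp_of_commute {R A : Type*} [CommRing R] [Ring A] (f : R →+* A)
    (hf : ∀ r x, f r * x = x * f r) (p q : Polynomial R) (x : A) :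
    (p.comp q).eval₂ f x = p.eval₂ f (q.eval₂ f x) :=
  letI := f.toAlgebra' hf
  Polynomial.aeval_comp x

lemma evalAt_comp {L : Type*} [LieRing L] [LieAlgebra ℂ L] (A : U L ⊗[ℂ] Module.End ℂ V)
    (p q : Polynomial (Z L)) : evalAt A (p.comp q) = evalAt (evalAt A q) p := by
  refine eval₂_comp_of_commute _ (fun z x => ?_) p q A
  change ((z : U L) ⊗ₜ[ℂ] (1 : Module.End ℂ V)) * x = x * ((z : U L) ⊗ₜ[ℂ] 1)
  induction x using TensorProduct.induction_on with
  | zero => rw [mul_zero, zero_mul]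
  | add x y hx hy => rw [mul_add, add_mul, hx, hy]
  | tmul y g =>
    rw [Algebra.TensorProduct.tmul_mul_tmul, Algebra.TensorProduct.tmul_mul_tmul, one_mul, mul_one,
      Subalgebra.mem_center_iff.mp z.2 y]

lemma evalAt_X_sub_C {L : Type*} [LieRing L] [LieAlgebra ℂ L] (A : U L ⊗[ℂ] Module.End ℂ V)
    (z : Z L) : evalAt A (Polynomial.X - Polynomial.C z) = A - (z : U L) ⊗ₜ 1 := by
  rw [evalAt, sub_eq_add_neg, ← Polynomial.C_neg, Polynomial.eval₂_add, Polynomial.eval₂_X,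
    Polynomial.eval₂_C, sub_eq_add_neg, ← TensorProduct.neg_tmul]
  rfl

lemma evalAt_map {L L' : Type*} [LieRing L] [LieAlgebra ℂ L] [LieRing L'] [LieAlgebra ℂ L']
    (g : U L →ₐ[ℂ] U L') (gZ : Z L →ₐ[ℂ] Z L') (hg : ∀ z : Z L, (gZ z : U L') = g z)
    (A : U L ⊗[ℂ] Module.End ℂ V) (p : Polynomial (Z L)) :
    evalAt (Algebra.TensorProduct.map g (AlgHom.id ℂ (Module.End ℂ V)) A)
      (p.map (gZ : Z L →+* Z L')) =
      Algebra.TensorProduct.map g (AlgHom.id ℂ (Module.End ℂ V)) (evalAt A p) := by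
  rw [evalAt, evalAt, Polynomial.eval₂_map]
  refine Eq.trans ?_ (Polynomial.hom_eval₂ p _
    (Algebra.TensorProduct.map g (AlgHom.id ℂ (Module.End ℂ V))).toRingHom A).symm
  congr 1
  refine RingHom.ext fun z => ?_
  change (gZ z : U L') ⊗ₜ[ℂ] (1 : Module.End ℂ V) = g z ⊗ₜ[ℂ] (1 : Module.End ℂ V)
  rw [hg]

end BraidedCasimir

end

/-! ### The two identities and the shift between them -/

theorem mainTheorem4 (n : ℕ) (hn : 1 ≤ n) (lam : Fin n → ℂ)
    (hlam : BraidedCasimir.IsDominant lam)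
    (V : Type*) [AddCommGroup V] [Module ℂ V]
    [LieRingModule (BraidedCasimir.gl n) V] [LieModule ℂ (BraidedCasimir.gl n) V]
    (hV : BraidedCasimir.IsIrrepOfHighestWeight V lam) :
    ∃ (p : Polynomial (BraidedCasimir.Z (BraidedCasimir.sl n)))
      (P : Polynomial (BraidedCasimir.Z (BraidedCasimir.gl n))),
      -- the characteristic identity for `sl n`
      p.degree = (Module.finrank ℂ V : ℕ) ∧
      BraidedCasimir.evalAt (BraidedCasimir.omegaSl n V) p = 0 ∧
      -- the characteristic identity for `gl n`
      P.degree = (Module.finrank ℂ V : ℕ) ∧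
      BraidedCasimir.evalAt (BraidedCasimir.Omega n V) P = 0 ∧
      -- `P(u) = p(u - (d / n) Δ)` with `d = ∑ λ_i`, an identity in `U(gl n)[u]`
      P.map ((BraidedCasimir.Z (BraidedCasimir.gl n)).val :
          BraidedCasimir.Z (BraidedCasimir.gl n) →+* BraidedCasimir.U (BraidedCasimir.gl n)) =
        (p.map (((BraidedCasimir.UslToUgl n).comp
            (BraidedCasimir.Z (BraidedCasimir.sl n)).val :
              BraidedCasimir.Z (BraidedCasimir.sl n) →ₐ[ℂ]
                BraidedCasimir.U (BraidedCasimir.gl n)) :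
              BraidedCasimir.Z (BraidedCasimir.sl n) →+*
                BraidedCasimir.U (BraidedCasimir.gl n))).comp
          (Polynomial.X - Polynomial.C (((∑ i, lam i) / (n : ℂ)) • BraidedCasimir.Delta n)) := by
  obtain ⟨P', hP', hdeg, hP'0⟩ := BraidedCasimir.exists_charIdentity hV
  have hδ : ((∑ i, lam i) / (n : ℂ)) • BraidedCasimir.Delta n ∈
      BraidedCasimir.Z (BraidedCasimir.gl n) := by
    rw [BraidedCasimir.Delta_eq]
    exact Subalgebra.smul_mem _ (BraidedCasimir.ι_one_mem_center n) _
  let δ : BraidedCasimir.Z (BraidedCasimir.gl n) :=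
    ⟨((∑ i, lam i) / (n : ℂ)) • BraidedCasimir.Delta n, hδ⟩
  let p := P'.map (BraidedCasimir.ZglToZsl n hn :
    BraidedCasimir.Z (BraidedCasimir.gl n) →+* BraidedCasimir.Z (BraidedCasimir.sl n))
  have hp : p.Monic := hP'.map _
  have hpdeg : p.natDegree = Module.finrank ℂ V := (hP'.natDegree_map _).trans hdeg
  have hp0 : BraidedCasimir.evalAt (BraidedCasimir.omegaSl n V) p = 0 := by
    rw [← BraidedCasimir.map_UglToUsl_Omega hn, BraidedCasimir.evalAt_map _ _ fun _ => rfl, hP'0,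
      map_zero]
  -- The final `gl n` polynomial is rebuilt from `p`, not taken to be `P'`, so the shift relation
  -- holds by construction; its identity is that of `p` transported along the inclusion.
  let q := p.map (BraidedCasimir.ZslToZgl n hn :
    BraidedCasimir.Z (BraidedCasimir.sl n) →+* BraidedCasimir.Z (BraidedCasimir.gl n))
  have hq : q.Monic := hp.map _
  have hqdeg : q.natDegree = Module.finrank ℂ V := (hp.natDegree_map _).trans hpdeg
  have hcomp : (q.comp (Polynomial.X - Polynomial.C δ)).Monic := hq.comp_X_sub_C δ
  refine ⟨p, q.comp (Polynomial.X - Polynomial.C δ), ?_, hp0, ?_, ?_, ?_⟩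
  · rw [Polynomial.degree_eq_natDegree hp.ne_zero, hpdeg]
  · rw [Polynomial.degree_eq_natDegree hcomp.ne_zero,
      Polynomial.natDegree_comp_eq_of_mul_ne_zero (by simp [hq.leadingCoeff]),
      Polynomial.natDegree_X_sub_C, mul_one, hqdeg]
  · rw [BraidedCasimir.evalAt_comp, BraidedCasimir.evalAt_X_sub_C,
      ← BraidedCasimir.map_UslToUgl_omegaSl hV hn,
      BraidedCasimir.evalAt_map _ _ fun _ => rfl, hp0, map_zero]
  · rw [Polynomial.map_comp, Polynomial.map_sub, Polynomial.map_X, Polynomial.map_C,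
      Polynomial.map_map]
    rfl
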